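/- **Theorem.** Let $p\ge 2$ and $t\ge 1$ be fixed integers. In the Quantum Congested Clique model, $n$ nodes with identifiers $1,\dots,n$ and no initial entanglement work in synchronous rounds. In each round every node may apply any quantum operation to the qubits it holds (local memory and computation are unbounded) and then send a message of $O(\log n)$ qubits to every other node. The input is a graph $G=(V,E)$ on the set $V$ of nodes, and each node $u\in V$ initially knows $n$, its identifier, its set of neighbours in $G$, and a set $S_u^p$ of $p$-cliques of $G$. Suppose that $S^p=\bigcup_{u\in V}S_u^p$ is the set of all $p$-cliques of $G$. Then for every constant $c>0$ there is an algorithm in this model that uses $\tilde O(n^{1-1/2^t})$ rounds and for which, for every such input, with probability at least $1-n^{-c}$, all nodes output $1$ if some $(p+t)$-clique of $G$ contains a $p$-clique of $S^p$, and all nodes output $0$ otherwise. Here $\tilde O(f(n))$ means $O(f(n)\log^k n)$ for some constant $k$, and all constants, including those in the message size, may depend on $p$, $t$ and $c$ only. -/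

import Mathlib

open Filter Asymptotics
open scoped Matrix

/-! ### The Quantum Congested Clique model

There are `n` nodes, identified with `Fin n`; each of them knows `n`, its own identifier and its
own local input, and nothing else. A node owns a work register of arbitrary finite dimension and,
for every node `u`, a register of `b` qubits (the bandwidth), used for communication with `u`. -/

/-- A message of `b` qubits has `Fin b → Bool` as its computational basis. -/
abbrev QMessage (b : ℕ) : Type := Fin b → Bool

/-- The computational basis of the registers of one node: a work register with basis `W`, and one
message register of `b` qubits for every node of the network. -/
abbrev QNodeBasis (n b : ℕ) (W : Type) : Type := W × (Fin n → QMessage b)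

/-- The computational basis of the whole network. A pure state of the network is a vector of
amplitudes `QNetBasis n b W → ℂ`. -/
abbrev QNetBasis (n b : ℕ) (W : Type) : Type := Fin n → QNodeBasis n b W

/-- An algorithm in the Quantum Congested Clique with `n` nodes, whose local inputs are of type
`I`. In round `r` the node `v`, whose local input is `i`, applies the unitary `gate v i r` to the
registers that it owns, after which the message registers are exchanged. After the last round every
node measures its registers in the computational basis and computes its output bit from its local
input and the outcome. There is no bound on local memory and local computation. -/
structure QCCAlgorithm (n : ℕ) (I : Type) where
  /-- the number of qubits of a message -/
  bandwidth : ℕ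
  /-- the number of communication rounds -/
  rounds : ℕ
  /-- the computational basis of the work register of a node -/
  Work : Type
  [workFintype : Fintype Work]
  [workDecidableEq : DecidableEq Work]
  /-- the initial basis state of the work registers -/
  start : Work
  /-- the local unitary operations -/
  gate : Fin n → I → ℕ → Matrix.unitaryGroup (QNodeBasis n bandwidth Work) ℂ
  /-- the output bit of a node -/
  output : Fin n → I → QNodeBasis n bandwidth Work → Bool

attribute [instance] QCCAlgorithm.workFintype QCCAlgorithm.workDecidableEq

/-- The tensor product of one operator per node, as an operator on the whole network. -/
def tensorOperator {n : ℕ} {L : Type} (U : Fin n → Matrix L L ℂ) :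
    Matrix (Fin n → L) (Fin n → L) ℂ :=
  Matrix.of fun x y => ∏ v, U v (x v) (y v)

/-- The exchange of messages on basis states: what `u` put into its register for `v` is found by
`v` in its register for `u`, for all `u` and `v` at the same time. This is an involution. -/
def exchangeMessages {n b : ℕ} {W : Type} (x : QNetBasis n b W) : QNetBasis n b W :=
  fun v => ((x v).1, fun u => (x u).2 v)

namespace QCCAlgorithm

variable {n : ℕ} {I : Type}

/-- The state of the network after `r` rounds on the local inputs `inp`. Initially all registers
are in fixed basis states, so that the nodes share no entanglement. In every round all nodes apply
their local unitaries, and then the message registers are exchanged. -/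
def state (A : QCCAlgorithm n I) (inp : Fin n → I) : ℕ → QNetBasis n A.bandwidth A.Work → ℂ
  | 0 => Pi.single (fun _ => (A.start, fun _ _ => false)) 1
  | r + 1 => fun x =>
      (tensorOperator (fun v => (A.gate v (inp v) r : Matrix _ _ ℂ)) *ᵥ A.state inp r)
        (exchangeMessages x)

open Classical in
/-- The probability that the vector of output bits of the nodes satisfies `P`. -/
noncomputable def outputProb (A : QCCAlgorithm n I) (inp : Fin n → I)
    (P : (Fin n → Bool) → Prop) : ℝ :=
  ∑ x, if P (fun v => A.output v (inp v) (x v)) then ‖A.state inp A.rounds x‖ ^ 2 else 0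

end QCCAlgorithm

/-- `f = Õ(g)`: up to a power of `log n`, `f` is at most a constant times `g`. -/
def IsSoftO (f g : ℕ → ℝ) : Prop :=
  ∃ k : ℕ, f =O[atTop] fun n => g n * Real.log n ^ k

/-! ### Extending cliques -/

/-- The local input of a node: the set of its neighbours in the input graph, and the set of cliques
(each as the finite set of its vertices) that it has found. -/
structure CliqueInput (n : ℕ) where
  neighbors : Set (Fin n)
  listed : Set (Finset (Fin n))

/-- The local inputs of the nodes when the input graph is `G` and node `u` has found the cliques
in `S u`. -/
def cliqueInput {n : ℕ} (G : SimpleGraph (Fin n)) (S : Fin n → Set (Finset (Fin n))) :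
    Fin n → CliqueInput n :=
  fun u => ⟨G.neighborSet u, S u⟩

/-- The sets `S u` consist of `p`-cliques of `G`, and each `p`-clique of `G` is in one of them. -/
def ListsAllCliques {n : ℕ} (G : SimpleGraph (Fin n)) (p : ℕ)
    (S : Fin n → Set (Finset (Fin n))) : Prop :=
  (⋃ u, S u) = {s | G.IsNClique p s}

/-- Some listed clique is contained in a `q`-clique of `G`. -/
def SomeListedExtends {n : ℕ} (G : SimpleGraph (Fin n)) (S : Fin n → Set (Finset (Fin n)))
    (q : ℕ) : Prop :=
  ∃ K : Finset (Fin n), G.IsNClique q K ∧ ∃ s ∈ ⋃ u, S u, s ⊆ K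

/-- The algorithms `A n`, for the numbers `n ≥ 1` of nodes, extend from `K_p` to `K_{p+t}` with
error probability at most `n ^ (-c)`: whenever the nodes have found all `p`-cliques of the input
graph, then with probability at least `1 - n ^ (-c)` every node outputs the correct answer to the
question whether some listed `p`-clique is contained in a `(p+t)`-clique. -/
def ExtendsCliques (p t : ℕ) (c : ℝ) (A : ∀ n : ℕ, QCCAlgorithm n (CliqueInput n)) : Prop :=
  ∀ n : ℕ, 1 ≤ n → ∀ (G : SimpleGraph (Fin n)) (S : Fin n → Set (Finset (Fin n))),
    ListsAllCliques G p S →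
      1 - (n : ℝ) ^ (-c) ≤ (A n).outputProb (cliqueInput G S)
        (fun out => ∀ v, out v = true ↔ SomeListedExtends G S (p + t))

set_option autoImplicit false
set_option synthInstance.maxSize 1000
set_option linter.unusedSectionVars false

/-! ### Averages of the orbit of a rotation -/

section Rotation

variable {E : Type*} [NormedAddCommGroup E] [InnerProductSpace ℂ E]

/-! The `t` missing vertices are found by nested quantum search with one level per vertex. At level
`i < t` the vertices are cut into batches of about `n^(1 - 1/2^i)`. A leader holds a batch number in
superposition and announces it, and every node then broadcasts one adjacency bit per vertex of the
batch. Once a batch is fixed at every level, each node tests its own cliques locally (`accepts`),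
and the leader collects the votes (`implements_flag`). There are about `n^(1/2^i)` batches, so
amplification costs about `n^(1/2^(i+1))` iterations, times a factor `k`. With `T i` the cost of the
search over the levels below `i`, this gives `T (i+1) ≈ k n^(1/2^(i+1)) (T i + n^(1 - 1/2^i))`. The
batch sizes balance the two summands, whence `T t ≈ k^t n^(1 - 1/2^t)` (`exists_searchCost_le`).

The number of solutions is unknown, and inner searches run coherently inside outer ones.
Amplification therefore uses a superposition of iteration numbers and tests whether the control
register has left its initial state. Without solutions the Grover iterate fixes the prepared state,
so the control returns exactly (`amplify_eq_zero`). Otherwise the part that returns is a `k`-th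
power of an averaged rotation applied to a vector, hence small (`amplify_miss`). The error is thus
one-sided and at most `2^(-k)` at every level (`searchU_eq_zero`, `searchU_miss`), and `k = O(log
n)` suffices.

In the network, `Implements` describes protocols that act exactly on an embedded basis. They compose
and can be inverted, so stored messages are erased after use and leave no unwanted entanglement
(`implements_search`). -/

theorem norm_sub_sq_of_rotation (G : E →L[ℂ] E) (hG : ∀ x, ‖G x‖ = ‖x‖) (a : ℝ) (φ : E)
    (h : G (G φ) + φ = ((2 - 4 * a : ℝ) : ℂ) • G φ) : ‖G φ - φ‖ ^ 2 = 4 * a * ‖φ‖ ^ 2 := by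
  have hin : ∀ x y, inner ℂ (G x) (G y) = inner ℂ x y :=
    (LinearMap.norm_map_iff_inner_map_map G.toLinearMap).1 hG
  have h1 := congrArg (fun z => inner ℂ (G φ) z) h
  simp only [inner_add_right, inner_smul_right, hin] at h1
  rw [inner_self_eq_norm_sq_to_K] at h1
  have h2 := congrArg Complex.re h1
  have h3 : (inner ℂ φ (G φ)).re = (inner ℂ (G φ) φ).re := by
    have := inner_re_symm (𝕜 := ℂ) φ (G φ)
    simpa using this
  rw [@norm_sub_sq ℂ, hG]
  have h4 : ((((2 - 4 * a : ℝ) : ℂ) * ((‖φ‖ : ℂ)) ^ 2)).re = (2 - 4 * a) * ‖φ‖ ^ 2 := by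
    rw [← Complex.ofReal_pow, ← Complex.ofReal_mul, Complex.ofReal_re]
  rw [Complex.add_re, h3] at h2
  have h5 := h2.trans h4
  simp only [RCLike.re_to_complex]
  linarith

/-- On the orbit of `φ` the recurrence reads `(G - 1)^2 = -4a G`. Multiplying the geometric sum by
`4a G` therefore telescopes to a difference of two vectors of norm `‖G φ - φ‖ = 2 √a ‖φ‖`. -/
theorem norm_sum_pow_rotation_le (G : E →L[ℂ] E) (hG : ∀ x, ‖G x‖ = ‖x‖) (a : ℝ) (ha : 0 < a)
    (φ : E) (h : G (G φ) + φ = ((2 - 4 * a : ℝ) : ℂ) • G φ) (M : ℕ) :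
    a * ‖(∑ m ∈ Finset.range M, G ^ m) φ‖ ^ 2 ≤ ‖φ‖ ^ 2 := by
  set S := (∑ m ∈ Finset.range M, G ^ m) φ with hS
  have hGp : ∀ m x, ‖(G ^ m) x‖ = ‖x‖ := by
    intro m
    induction m with
    | zero => simp
    | succ m ih => intro x; rw [pow_succ, _root_.mul_apply_eq_comp, ih, hG]
  have htel : ∀ M : ℕ, ((4 * a : ℝ) : ℂ) • G ((∑ m ∈ Finset.range M, G ^ m) φ)
      = (G φ - φ) - (G ^ M) (G φ - φ) := by
    intro M
    induction M with
    | zero => simp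
    | succ M ih =>
      rw [Finset.sum_range_succ, _root_.add_apply, map_add, smul_add, ih]
      have hc : ∀ x, G ((G ^ M) x) = (G ^ M) (G x) := fun x => by
        rw [← _root_.mul_apply_eq_comp, ← _root_.mul_apply_eq_comp, ← pow_succ, pow_succ']
      rw [hc, pow_succ, _root_.mul_apply_eq_comp]
      have h' : ((4 * a : ℝ) : ℂ) • G φ = (G φ - φ) - G (G φ - φ) := by
        have : ((4 * a : ℝ) : ℂ) • G φ = (2 : ℂ) • G φ - ((2 - 4 * a : ℝ) : ℂ) • G φ := by
          rw [← sub_smul]; push_cast; ring_nf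
        rw [this, ← h, map_sub, two_smul]; abel
      rw [← map_smul, h']; simp only [map_sub]; abel
  have h1 : 4 * a * ‖S‖ ≤ 2 * ‖G φ - φ‖ := by
    have := congrArg norm (htel M)
    rw [norm_smul, hG, Complex.norm_real, Real.norm_of_nonneg (by positivity)] at this
    rw [← hS] at this
    rw [this]
    refine (norm_sub_le _ _).trans ?_
    rw [hGp]; linarith
  have h2 := norm_sub_sq_of_rotation G hG a φ h
  have h3 : (4 * a * ‖S‖) ^ 2 ≤ (2 * ‖G φ - φ‖) ^ 2 := by gcongr
  have h4 : (16 * a) * (a * ‖S‖ ^ 2) ≤ (16 * a) * ‖φ‖ ^ 2 := by nlinarith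
  exact le_of_mul_le_mul_left h4 (by positivity)

/-- The sum commutes with `G`, so its powers applied to `φ` satisfy the same recurrence and each
factor gains `1/√a`. -/
theorem norm_pow_sum_pow_rotation_le (G : E →L[ℂ] E) (hG : ∀ x, ‖G x‖ = ‖x‖) (a : ℝ)
    (ha : 0 < a) (φ : E) (h : G (G φ) + φ = ((2 - 4 * a : ℝ) : ℂ) • G φ) (M k : ℕ) :
    a ^ k * ‖((∑ m ∈ Finset.range M, G ^ m) ^ k) φ‖ ^ 2 ≤ ‖φ‖ ^ 2 := by
  induction k with
  | zero => simp
  | succ k ih =>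
    set B := ∑ m ∈ Finset.range M, G ^ m with hB
    have hc : ∀ x, G ((B ^ k) x) = (B ^ k) (G x) := by
      have : Commute G (B ^ k) := by
        apply Commute.pow_right
        exact Commute.sum_right _ _ _ fun m _ => (Commute.refl G).pow_right m
      intro x
      exact congrArg (fun T : E →L[ℂ] E => T x) this.eq
    have h' : G (G ((B ^ k) φ)) + (B ^ k) φ = ((2 - 4 * a : ℝ) : ℂ) • G ((B ^ k) φ) := by
      rw [hc, hc, ← map_add, h, map_smul]
    have := norm_sum_pow_rotation_le G hG a ha ((B ^ k) φ) h' M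
    rw [← hB] at this
    rw [pow_succ', pow_succ' B, _root_.mul_apply_eq_comp]
    calc a * a ^ k * ‖B ((B ^ k) φ)‖ ^ 2 = a ^ k * (a * ‖B ((B ^ k) φ)‖ ^ 2) := by ring
      _ ≤ a ^ k * ‖(B ^ k) φ‖ ^ 2 := by gcongr
      _ ≤ ‖φ‖ ^ 2 := ih

end Rotation

theorem sum_pow_sum_eq_pow {R : Type*} [Ring R] (x : R) (M k : ℕ) :
    ∑ j : Fin k → Fin M, x ^ (∑ i, (j i : ℕ)) = (∑ m ∈ Finset.range M, x ^ m) ^ k := by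
  -- Expanding a product of sums needs commutativity: the identity is proved for polynomials and
  -- evaluated at `x`.
  have h : ∑ j : Fin k → Fin M, (Polynomial.X : Polynomial ℤ) ^ (∑ i, (j i : ℕ))
      = (∑ m ∈ Finset.range M, Polynomial.X ^ m) ^ k := by
    rw [← Fin.sum_univ_eq_sum_range (fun m => (Polynomial.X : Polynomial ℤ) ^ m), ← Fin.prod_const,
      Finset.prod_univ_sum]
    simp [Finset.prod_pow_eq_pow_sum]
  have h2 := congrArg (Polynomial.aeval x) h
  simpa using h2

/-! ### Unitary matrices -/

namespace QSearch

/-- The unitary operators on the space with orthonormal basis `X`. -/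
abbrev Unitary (X : Type) [Fintype X] [DecidableEq X] : Type := Matrix.unitaryGroup X ℂ

variable {X Z J C : Type} [Fintype X] [DecidableEq X] [Fintype Z] [DecidableEq Z]
  [Fintype J] [DecidableEq J] [Fintype C] [DecidableEq C]

theorem blockDiagonal_mem_unitaryGroup (f : J → Unitary Z) :
    Matrix.blockDiagonal (fun j => (f j : Matrix Z Z ℂ)) ∈ Matrix.unitaryGroup (Z × J) ℂ := by
  rw [Matrix.mem_unitaryGroup_iff, Matrix.star_eq_conjTranspose,
    Matrix.blockDiagonal_conjTranspose, ← Matrix.blockDiagonal_mul]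
  have : (fun j => (f j : Matrix Z Z ℂ) * (f j : Matrix Z Z ℂ)ᴴ) = 1 := by
    funext j; exact (Matrix.mem_unitaryGroup_iff.1 (f j).2)
  rw [this, Matrix.blockDiagonal_one]

/-- The operator that applies `f j` when the second register is in the basis state `j`. -/
def blockU : (J → Unitary Z) →* Unitary (Z × J) where
  toFun f := ⟨Matrix.blockDiagonal fun j => (f j : Matrix Z Z ℂ), blockDiagonal_mem_unitaryGroup f⟩
  map_one' := by
    apply Subtype.ext
    exact Matrix.blockDiagonal_one
  map_mul' f g := by
    apply Subtype.ext
    exact Matrix.blockDiagonal_mul (fun j => (f j).1) (fun j => (g j).1)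

theorem blockU_apply (f : J → Unitary Z) (x y : Z × J) :
    (blockU f : Matrix _ _ ℂ) x y = if x.2 = y.2 then (f x.2 : Matrix _ _ ℂ) x.1 y.1 else 0 :=
  Matrix.blockDiagonal_apply (fun j => (f j).1) x y

/-- The operator that acts on the second register only. -/
def rightU : Unitary J →* Unitary (Z × J) where
  toFun H := ⟨Matrix.kroneckerMap (· * ·) (1 : Matrix Z Z ℂ) H.1,
    Matrix.kronecker_mem_unitary (one_mem _) H.2⟩
  map_one' := by
    apply Subtype.ext
    exact Matrix.one_kronecker_one (m := Z) (n := J) (α := ℂ)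
  map_mul' f g := by
    apply Subtype.ext
    have h := Matrix.mul_kronecker_mul (1 : Matrix Z Z ℂ) (1 : Matrix Z Z ℂ) f.1 g.1
    rw [one_mul] at h
    exact h

theorem rightU_apply (H : Unitary J) (x y : Z × J) :
    (rightU H : Unitary (Z × J)).1 x y = if x.1 = y.1 then H.1 x.2 y.2 else 0 := by
  change (1 : Matrix Z Z ℂ) x.1 y.1 * H.1 x.2 y.2 = _
  rw [Matrix.one_apply]; split_ifs <;> simp

/-- The diagonal operator that changes the sign of the basis states in `s`. -/
def phaseFlip (s : X → Bool) : Unitary X :=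
  ⟨Matrix.diagonal fun x => if s x then -1 else 1, by
    rw [Matrix.mem_unitaryGroup_iff, Matrix.star_eq_conjTranspose, Matrix.diagonal_conjTranspose,
      Matrix.diagonal_mul_diagonal, ← Matrix.diagonal_one]
    congr 1; funext x; by_cases h : s x <;> simp [h]⟩

theorem phaseFlip_apply (s : X → Bool) (x y : X) :
    (phaseFlip s : Matrix _ _ ℂ) x y = if x = y then (if s x then -1 else 1) else 0 :=
  Matrix.diagonal_apply _ _ _

theorem phaseFlip_block (s : J → Z → Bool) :
    phaseFlip (fun x : Z × J => s x.2 x.1) = blockU fun j => phaseFlip (s j) := by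
  ext ⟨z, j⟩ ⟨z', j'⟩
  simp only [phaseFlip_apply, blockU_apply, Prod.mk.injEq]
  split_ifs <;> simp_all

theorem phaseFlip_mulVec (s : X → Bool) (φ : X → ℂ) (x : X) :
    ((phaseFlip s : Matrix _ _ ℂ) *ᵥ φ) x = if s x then -φ x else φ x := by
  change (Matrix.diagonal _ *ᵥ φ) x = _
  rw [Matrix.mulVec_diagonal]; split_ifs <;> simp

/-- The Householder reflection along the difference of the basis vector at `j₀` and the uniform unit
vector exchanges the two. -/
theorem exists_unitary_uniform (j₀ : J) :
    ∃ H : Unitary J, ∀ j, H.1 j j₀ = (((Real.sqrt (Fintype.card J))⁻¹ : ℝ) : ℂ) := by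
  classical
  set c : ℝ := (Real.sqrt (Fintype.card J))⁻¹ with hc
  have hcard : (0 : ℝ) < Fintype.card J := by
    have : Nonempty J := ⟨j₀⟩
    exact_mod_cast Fintype.card_pos
  have hcc : (Fintype.card J : ℝ) * c ^ 2 = 1 := by
    rw [hc, inv_pow, Real.sq_sqrt hcard.le]; field_simp
  set v : J → ℂ := fun j => (if j = j₀ then 1 else 0) - c with hv
  set d : ℂ := 1 - c with hd
  have hvs : star v = v := by
    funext j; simp only [hv, Pi.star_apply, star_sub]; split_ifs <;> simp
  have hvv : v ⬝ᵥ v = 2 * d := by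
    have : ∀ j, v j * v j = (if j = j₀ then (1 - 2 * (c : ℂ)) else 0) + (c : ℂ) ^ 2 := by
      intro j; simp only [hv]; split_ifs <;> ring
    simp only [dotProduct, this, Finset.sum_add_distrib, Finset.sum_ite_eq', Finset.mem_univ,
      if_true, Finset.sum_const, Finset.card_univ, nsmul_eq_mul]
    have : (Fintype.card J : ℂ) * (c : ℂ) ^ 2 = 1 := by exact_mod_cast hcc
    rw [this, hd]; ring
  set A : Matrix J J ℂ := 1 - d⁻¹ • Matrix.vecMulVec v v with hA
  have hds : star d = d := by simp [hd]
  have hAs : star A = A := by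
    rw [hA, star_sub, star_one, star_smul, star_inv₀, hds, Matrix.star_eq_conjTranspose,
      Matrix.conjTranspose_vecMulVec, hvs]
  have hAA : A * A = 1 := by
    have h1 : Matrix.vecMulVec v v * Matrix.vecMulVec v v = (2 * d) • Matrix.vecMulVec v v := by
      rw [Matrix.vecMulVec_mul_vecMulVec, hvv, Matrix.vecMulVec_smul]
    rw [hA, sub_mul, mul_sub, mul_sub, one_mul, mul_one, one_mul, smul_mul_smul_comm, h1, smul_smul]
    -- This is the case of a one-element `J`: the two vectors coincide, and `d⁻¹ = 0` turns `A` into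
    -- the identity.
    by_cases h0 : d = 0
    · simp [h0]
    · have : d⁻¹ * d⁻¹ * (2 * d) = d⁻¹ + d⁻¹ := by field_simp; norm_num
      rw [this, add_smul]; abel
  refine ⟨⟨A, ?_⟩, ?_⟩
  · rw [Matrix.mem_unitaryGroup_iff, hAs, hAA]
  · intro j
    change A j j₀ = _
    simp only [hA, Matrix.sub_apply, Matrix.one_apply, Matrix.smul_apply, Matrix.vecMulVec_apply,
      smul_eq_mul]
    have hvj : v j₀ = d := by simp [hv, hd]
    rw [hvj]
    by_cases h0 : d = 0
    · have hc1 : c = 1 := by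
        have : (c : ℂ) = 1 := (sub_eq_zero.1 h0).symm
        exact_mod_cast this
      have hc1' : Fintype.card J = 1 := by
        rw [hc1] at hcc; simpa using hcc
      have : j = j₀ := (Fintype.card_le_one_iff.1 hc1'.le) j j₀
      simp [this, hc1, h0]
    · have : d⁻¹ * (v j * d) = v j := by field_simp
      rw [this]; simp [hv]

/-- A unitary operator that takes the basis state `j₀` to the uniform superposition. -/
noncomputable def uniformU (j₀ : J) : Unitary J := (exists_unitary_uniform j₀).choose

theorem uniformU_apply (j₀ j : J) :
    (uniformU j₀).1 j j₀ = (((Real.sqrt (Fintype.card J))⁻¹ : ℝ) : ℂ) :=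
  (exists_unitary_uniform j₀).choose_spec j

theorem rightU_mul_blockU_mul_rightU_apply (A B : Unitary J) (f : J → Unitary Z) (x y : Z × J) :
    (rightU A * blockU f * rightU B : Unitary (Z × J)).1 x y
      = ∑ j, A.1 x.2 j * (f j).1 x.1 y.1 * B.1 j y.2 := by
  change (((rightU A : Unitary (Z × J)).1 * (blockU f).1) * (rightU B : Unitary (Z × J)).1) x y = _
  have h1 : ∀ w : Z × J, ((rightU A : Unitary (Z × J)).1 * (blockU f).1) x w
      = A.1 x.2 w.2 * (f w.2).1 x.1 w.1 := by
    intro w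
    rw [Matrix.mul_apply, Fintype.sum_prod_type]
    simp only [rightU_apply, blockU_apply, ite_mul, zero_mul, mul_ite, mul_zero]
    rw [Finset.sum_eq_single x.1 (fun b _ hb => by simp [hb.symm]) (by simp)]
    rw [Finset.sum_eq_single w.2 (fun b _ hb => by simp [hb]) (by simp)]
    simp
  rw [Matrix.mul_apply, Fintype.sum_prod_type, Finset.sum_comm]
  simp only [h1, rightU_apply, mul_ite, mul_zero]
  simp

/-! ### Amplitude amplification -/

/-- One iteration of amplitude amplification for the preparation `D` of a state from `z₀`. -/
def groverIterate (D : Unitary Z) (z₀ : Z) (P : Z → Bool) : Unitary Z :=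
  D * phaseFlip (fun z => decide (z ≠ z₀)) * D⁻¹ * phaseFlip P

/-- The `m`-th iteration, executed when the control register asks for more than `m` iterations. -/
def controlledStep (D : Unitary Z) (z₀ : Z) (P : Z → Bool) (e : J → ℕ) (m : ℕ) :
    Unitary (Z × J) :=
  blockU (fun _ => D) * phaseFlip (fun x => decide (x.1 ≠ z₀) && decide (m < e x.2)) *
    (blockU fun _ => D)⁻¹ * phaseFlip (fun x => P x.1 && decide (m < e x.2))

/-- The first `m` controlled iterations. -/
def controlledIterate (D : Unitary Z) (z₀ : Z) (P : Z → Bool) (e : J → ℕ) : ℕ → Unitary (Z × J)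
  | 0 => 1
  | m + 1 => controlledStep D z₀ P e m * controlledIterate D z₀ P e m

/-- Amplitude amplification with a superposition of numbers of iterations: the number of iterations
is `e j`, where `j` is uniform, and the last operator maps the uniform superposition to `j₀`. -/
noncomputable def amplify (D : Unitary Z) (z₀ : Z) (P : Z → Bool) (j₀ : J) (e : J → ℕ) (K : ℕ) :
    Unitary (Z × J) :=
  (rightU (uniformU j₀))⁻¹ * controlledIterate D z₀ P e K * blockU (fun _ => D) *
    rightU (uniformU j₀)

/-- Only the phase flips are controlled. Where they are off, `D` cancels against `D⁻¹`, so the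
network never has to execute a controlled `D`. -/
theorem controlledStep_eq (D : Unitary Z) (z₀ : Z) (P : Z → Bool) (e : J → ℕ) (m : ℕ) :
    controlledStep D z₀ P e m = blockU fun j => if m < e j then groverIterate D z₀ P else 1 := by
  rw [controlledStep, phaseFlip_block (fun j z => decide (z ≠ z₀) && decide (m < e j)),
    phaseFlip_block (fun j z => P z && decide (m < e j)), ← map_inv, ← map_mul, ← map_mul,
    ← map_mul]
  congr 1; funext j
  simp only [Pi.mul_apply, Pi.inv_apply]
  by_cases h : m < e j
  · simp [h, groverIterate]
  · have : phaseFlip (fun _ : Z => false) = 1 := by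
      ext x y; simp [phaseFlip_apply, Matrix.one_apply]
    simp [h, this]

theorem controlledIterate_eq (D : Unitary Z) (z₀ : Z) (P : Z → Bool) (e : J → ℕ) (m : ℕ) :
    controlledIterate D z₀ P e m = blockU fun j => groverIterate D z₀ P ^ min m (e j) := by
  induction m with
  | zero => simp only [controlledIterate, Nat.zero_min, pow_zero]; exact (map_one blockU).symm
  | succ m ih =>
    rw [controlledIterate, ih, controlledStep_eq, ← map_mul]
    congr 1; funext j
    simp only [Pi.mul_apply]
    split_ifs with h
    · rw [← pow_succ']; congr 1; omega
    · rw [one_mul]; congr 1; omega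

theorem amplify_apply (D : Unitary Z) (z₀ : Z) (P : Z → Bool) (j₀ : J) (e : J → ℕ) (K : ℕ)
    (hK : ∀ j, e j ≤ K) (x : Z × J) :
    (amplify D z₀ P j₀ e K).1 x (z₀, j₀) = ∑ j, ((uniformU j₀)⁻¹).1 x.2 j *
      (groverIterate D z₀ P ^ e j * D).1 x.1 z₀ * (uniformU j₀).1 j j₀ := by
  have : amplify D z₀ P j₀ e K = rightU (uniformU j₀)⁻¹ *
      blockU (fun j => groverIterate D z₀ P ^ e j * D) * rightU (uniformU j₀) := by
    rw [amplify, controlledIterate_eq, map_inv, mul_assoc _ (blockU _) (blockU _), ← map_mul]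
    congr 3; funext j; simp [hK j]
  rw [this, rightU_mul_blockU_mul_rightU_apply]

/-- The probability that a measurement of the state `U|z₀⟩` has an outcome in `P`. -/
noncomputable def hitProb (U : Unitary Z) (z₀ : Z) (P : Z → Bool) : ℝ :=
  ∑ z, if P z then ‖U.1 z z₀‖ ^ 2 else 0

theorem sum_norm_sq_unitary (U : Unitary Z) (z₀ : Z) : ∑ z, ‖U.1 z z₀‖ ^ 2 = 1 := by
  have h := congrFun (congrFun (Matrix.mem_unitaryGroup_iff'.1 U.2) z₀) z₀
  rw [Matrix.mul_apply, Matrix.one_apply_eq] at h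
  have h2 : ∀ z, (star U.1) z₀ z * U.1 z z₀ = ((‖U.1 z z₀‖ ^ 2 : ℝ) : ℂ) := by
    intro z
    rw [Matrix.star_apply, RCLike.star_def, RCLike.conj_mul]; push_cast; rfl
  simp only [h2] at h
  exact_mod_cast h

theorem hitProb_add_not (U : Unitary Z) (z₀ : Z) (P : Z → Bool) :
    hitProb U z₀ P + hitProb U z₀ (fun z => !P z) = 1 := by
  rw [hitProb, hitProb, ← Finset.sum_add_distrib, ← sum_norm_sq_unitary U z₀]
  refine Finset.sum_congr rfl fun z _ => ?_
  cases P z <;> simp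

/-- The restriction of a vector to the basis states in `P`. -/
def restrict (P : Z → Bool) (φ : Z → ℂ) : Z → ℂ := fun z => if P z then φ z else 0

theorem phaseFlip_mulVec_eq (P : Z → Bool) (φ : Z → ℂ) :
    (phaseFlip P : Matrix _ _ ℂ) *ᵥ φ = φ - (2 : ℂ) • restrict P φ := by
  funext z
  rw [phaseFlip_mulVec]
  simp only [Pi.sub_apply, Pi.smul_apply, restrict, smul_eq_mul]
  split_ifs <;> ring

/-- The flip is `2|z₀⟩⟨z₀| - 1`; conjugation by `D` makes it the reflection about the prepared
state. -/
theorem conj_phaseFlip_mulVec (D : Unitary Z) (z₀ : Z) (φ : Z → ℂ) :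
    (D * phaseFlip (fun z => decide (z ≠ z₀)) * D⁻¹ : Unitary Z).1 *ᵥ φ
      = (2 * (star (fun z => D.1 z z₀) ⬝ᵥ φ)) • (fun z => D.1 z z₀) - φ := by
  change (D.1 * (phaseFlip fun z => decide (z ≠ z₀)).1 * (D⁻¹).1) *ᵥ φ = _
  rw [← Matrix.mulVec_mulVec, ← Matrix.mulVec_mulVec]
  have h1 : (phaseFlip fun z => decide (z ≠ z₀)).1 *ᵥ ((D⁻¹).1 *ᵥ φ)
      = (2 * (star (fun z => D.1 z z₀) ⬝ᵥ φ)) • Pi.single z₀ 1 - (D⁻¹).1 *ᵥ φ := by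
    funext z
    rw [phaseFlip_mulVec]
    simp only [Pi.sub_apply, Pi.smul_apply, smul_eq_mul, Pi.single_apply]
    by_cases h : z = z₀
    · subst h
      have : ((D⁻¹).1 *ᵥ φ) z = star (fun y => D.1 y z) ⬝ᵥ φ := by
        simp [Matrix.mulVec, dotProduct, Matrix.star_apply]
      rw [← this]; simp; ring
    · simp [h]
  rw [h1, Matrix.mulVec_sub, Matrix.mulVec_smul, Matrix.mulVec_mulVec]
  have h2 : D.1 * (D⁻¹).1 = 1 := by
    simp
  rw [h2, Matrix.one_mulVec, Matrix.mulVec_single_one]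
  rfl

theorem groverIterate_mulVec (D : Unitary Z) (z₀ : Z) (P : Z → Bool) (φ : Z → ℂ) :
    (groverIterate D z₀ P).1 *ᵥ φ
      = (2 * (star (fun z => D.1 z z₀) ⬝ᵥ (φ - (2 : ℂ) • restrict P φ))) • (fun z => D.1 z z₀)
        - (φ - (2 : ℂ) • restrict P φ) := by
  rw [← phaseFlip_mulVec_eq, ← conj_phaseFlip_mulVec, Matrix.mulVec_mulVec]
  rfl

theorem star_dotProduct_col (D : Unitary Z) (z₀ : Z) :
    star (fun z => D.1 z z₀) ⬝ᵥ (fun z => D.1 z z₀) = 1 := by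
  have h := congrFun (congrFun (Matrix.mem_unitaryGroup_iff'.1 D.2) z₀) z₀
  rw [Matrix.mul_apply, Matrix.one_apply_eq] at h
  exact h

theorem star_dotProduct_restrict_col (D : Unitary Z) (z₀ : Z) (P : Z → Bool) :
    star (fun z => D.1 z z₀) ⬝ᵥ restrict P (fun z => D.1 z z₀) = (hitProb D z₀ P : ℂ) := by
  rw [hitProb, dotProduct, Complex.ofReal_sum]
  refine Finset.sum_congr rfl fun z _ => ?_
  simp only [restrict, Pi.star_apply]
  split_ifs
  · rw [RCLike.star_def, RCLike.conj_mul]; push_cast; rfl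
  · simp

/-- With `ψ` the prepared state, `ψ` and its restriction to `P` are mapped to combinations of each
other by a 2×2 matrix of determinant `1` and trace `2 - 4a`; the identity is Cayley–Hamilton. -/
theorem groverIterate_rotation (D : Unitary Z) (z₀ : Z) (P : Z → Bool) :
    (groverIterate D z₀ P).1 *ᵥ ((groverIterate D z₀ P).1 *ᵥ fun z => D.1 z z₀)
        + (fun z => D.1 z z₀)
      = ((2 - 4 * hitProb D z₀ P : ℝ) : ℂ) • ((groverIterate D z₀ P).1 *ᵥ fun z => D.1 z z₀) := by
  set ψ : Z → ℂ := fun z => D.1 z z₀ with hψ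
  set a := hitProb D z₀ P with ha
  have h1 : star ψ ⬝ᵥ ψ = 1 := star_dotProduct_col D z₀
  have h2 : star ψ ⬝ᵥ restrict P ψ = (a : ℂ) := star_dotProduct_restrict_col D z₀ P
  have hrr : restrict P (restrict P ψ) = restrict P ψ := by
    funext z; simp only [restrict]; split_ifs <;> rfl
  have hG1 : (groverIterate D z₀ P).1 *ᵥ ψ = (1 - 4 * a : ℂ) • ψ + (2 : ℂ) • restrict P ψ := by
    rw [groverIterate_mulVec, ← hψ, dotProduct_sub, dotProduct_smul, h1, h2]
    funext z; simp only [Pi.sub_apply, Pi.add_apply, Pi.smul_apply, smul_eq_mul]; ring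
  have hG2 : (groverIterate D z₀ P).1 *ᵥ restrict P ψ = (-2 * a : ℂ) • ψ + restrict P ψ := by
    rw [groverIterate_mulVec, ← hψ, dotProduct_sub, dotProduct_smul, hrr, h2]
    funext z; simp only [Pi.sub_apply, Pi.add_apply, Pi.smul_apply, smul_eq_mul]; ring
  rw [hG1, Matrix.mulVec_add, Matrix.mulVec_smul, Matrix.mulVec_smul, hG1, hG2]
  funext z
  simp only [Pi.add_apply, Pi.smul_apply, smul_eq_mul]
  push_cast; ring

theorem groverIterate_fix (D : Unitary Z) (z₀ : Z) (P : Z → Bool)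
    (h : ∀ z, P z → D.1 z z₀ = 0) (m : ℕ) :
    ∀ z, (groverIterate D z₀ P ^ m * D).1 z z₀ = D.1 z z₀ := by
  set ψ : Z → ℂ := fun z => D.1 z z₀ with hψ
  have hr : restrict P ψ = 0 := by
    funext z; simp only [restrict]; split_ifs with hz
    · exact h z hz
    · rfl
  have hG : (groverIterate D z₀ P).1 *ᵥ ψ = ψ := by
    rw [groverIterate_mulVec, ← hψ, hr, smul_zero, sub_zero, star_dotProduct_col]
    funext z; simp only [Pi.sub_apply, Pi.smul_apply, smul_eq_mul]; ring
  have hGm : (groverIterate D z₀ P ^ m).1 *ᵥ ψ = ψ := by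
    induction m with
    | zero => exact Matrix.one_mulVec ψ
    | succ m ih =>
      have : (groverIterate D z₀ P ^ (m + 1)).1
          = (groverIterate D z₀ P ^ m).1 * (groverIterate D z₀ P).1 := by
        rw [pow_succ]; rfl
      rw [this, ← Matrix.mulVec_mulVec, hG, ih]
  intro z
  exact congrFun hGm z

/-- All numbers of iterations give the same state, so the control stays unentangled and its
preparation is undone exactly. -/
theorem amplify_eq_zero (D : Unitary Z) (z₀ : Z) (P : Z → Bool) (j₀ : J) (e : J → ℕ) (K : ℕ)
    (hK : ∀ j, e j ≤ K) (h : ∀ z, P z → D.1 z z₀ = 0) (x : Z × J) (hx : x.2 ≠ j₀) :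
    (amplify D z₀ P j₀ e K).1 x (z₀, j₀) = 0 := by
  rw [amplify_apply D z₀ P j₀ e K hK]
  have h1 : ∀ j, ((uniformU j₀)⁻¹).1 x.2 j * (groverIterate D z₀ P ^ e j * D).1 x.1 z₀ *
      (uniformU j₀).1 j j₀ = D.1 x.1 z₀ * (((uniformU j₀)⁻¹).1 x.2 j * (uniformU j₀).1 j j₀) := by
    intro j; rw [groverIterate_fix D z₀ P h (e j)]; ring
  simp only [h1]
  rw [← Finset.mul_sum, ← Matrix.mul_apply]
  have h2 : ((uniformU j₀)⁻¹).1 * (uniformU j₀).1 = 1 := by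
    simp
  rw [h2, Matrix.one_apply_ne hx, mul_zero]

/-- The part with control `0` is the average of `G ^ e j` applied to the prepared state. As `e j` is
a sum of `k` independent coordinates, the average is a `k`-th power, to which the rotation bound
applies. -/
theorem amplify_miss (D : Unitary Z) (z₀ : Z) (P : Z → Bool) (M k K : ℕ)
    (hK : ∀ j : Fin k → Fin (M + 1), ∑ i, (j i : ℕ) ≤ K) (hP : 0 < hitProb D z₀ P) :
    (hitProb D z₀ P * (M + 1) ^ 2) ^ k *
      ∑ z, ‖(amplify D z₀ P (0 : Fin k → Fin (M + 1)) (fun j => ∑ i, (j i : ℕ)) K).1 (z, 0) (z₀, 0)‖ ^ 2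
      ≤ 1 := by
  set G := Matrix.toEuclideanCLM (𝕜 := ℂ) (groverIterate D z₀ P).1 with hGdef
  set ψ : Z → ℂ := fun z => D.1 z z₀ with hψ
  have hG : ∀ x, ‖G x‖ = ‖x‖ := by
    apply ContinuousLinearMap.norm_map_of_mem_unitary
    exact Unitary.map_mem _ (groverIterate D z₀ P).2
  have hrot : G (G (WithLp.toLp 2 ψ)) + WithLp.toLp 2 ψ
      = ((2 - 4 * hitProb D z₀ P : ℝ) : ℂ) • G (WithLp.toLp 2 ψ) := by
    rw [hGdef, Matrix.toEuclideanCLM_toLp, Matrix.toEuclideanCLM_toLp, ← WithLp.toLp_add,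
      groverIterate_rotation, WithLp.toLp_smul]
  have hmain := norm_pow_sum_pow_rotation_le G hG _ hP (WithLp.toLp 2 ψ) hrot (M + 1) k
  rw [← sum_pow_sum_eq_pow] at hmain
  have hψn : ‖(WithLp.toLp 2 ψ : EuclideanSpace ℂ Z)‖ ^ 2 = 1 := by
    rw [EuclideanSpace.norm_sq_eq]; exact sum_norm_sq_unitary D z₀
  rw [hψn] at hmain
  have hcol : ∀ z, (amplify D z₀ P (0 : Fin k → Fin (M + 1)) (fun j => ∑ i, (j i : ℕ)) K).1
      (z, 0) (z₀, 0) = ((((M + 1 : ℝ) ^ k)⁻¹ : ℝ) : ℂ) *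
        ((∑ j : Fin k → Fin (M + 1), G ^ (∑ i, (j i : ℕ))) (WithLp.toLp 2 ψ)).ofLp z := by
    intro z
    rw [amplify_apply D z₀ P _ _ K hK]
    have hGm : ∀ m, ((G ^ m) (WithLp.toLp 2 ψ)).ofLp z
        = (groverIterate D z₀ P ^ m * D).1 z z₀ := by
      intro m
      rw [hGdef, ← map_pow, Matrix.toEuclideanCLM_toLp]
      rfl
    rw [_root_.sum_apply, WithLp.ofLp_sum, Finset.sum_apply, Finset.mul_sum]
    refine Finset.sum_congr rfl fun j _ => ?_
    rw [hGm]
    have hinv : ((uniformU (0 : Fin k → Fin (M + 1)))⁻¹).1 0 j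
        = star ((uniformU (0 : Fin k → Fin (M + 1))).1 j 0) := rfl
    simp only [hinv]
    rw [uniformU_apply]
    have hc : (((Real.sqrt (Fintype.card (Fin k → Fin (M + 1))))⁻¹ : ℝ) : ℂ) *
        (((Real.sqrt (Fintype.card (Fin k → Fin (M + 1))))⁻¹ : ℝ) : ℂ)
        = ((((M + 1 : ℝ) ^ k)⁻¹ : ℝ) : ℂ) := by
      rw [← Complex.ofReal_mul, ← mul_inv, Real.mul_self_sqrt (by positivity)]
      simp
    rw [← hc, RCLike.star_def, Complex.conj_ofReal]
    ring
  simp only [hcol, norm_mul, mul_pow]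
  rw [← Finset.mul_sum, ← EuclideanSpace.norm_sq_eq]
  calc _ = hitProb D z₀ P ^ k * ‖(∑ j : Fin k → Fin (M + 1), G ^ (∑ i, (j i : ℕ))) (WithLp.toLp 2 ψ)‖ ^ 2 := by
        rw [Complex.norm_real, norm_inv, norm_pow, Real.norm_of_nonneg (by positivity)]
        rw [← pow_mul, inv_pow, ← pow_mul, mul_comm k 2]
        field_simp
    _ ≤ 1 := hmain


variable {X Y Z J C : Type} [Fintype X] [DecidableEq X] [Fintype Y] [DecidableEq Y]
  [Fintype Z] [DecidableEq Z] [Fintype J] [DecidableEq J] [Fintype C] [DecidableEq C]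

/-! ### Protocols -/

theorem tensorOperator_mul {n : ℕ} {L : Type} [Fintype L] [DecidableEq L]
    (U V : Fin n → Matrix L L ℂ) :
    tensorOperator U * tensorOperator V = tensorOperator fun v => U v * V v := by
  ext x y
  simp only [Matrix.mul_apply, tensorOperator, Matrix.of_apply]
  rw [Finset.prod_univ_sum, Fintype.piFinset_univ]
  exact Finset.sum_congr rfl fun z _ => Finset.prod_mul_distrib.symm

theorem prod_ite_eq_funext {n : ℕ} {L : Type} [DecidableEq L] (x y : Fin n → L) :
    (∏ v, if x v = y v then (1 : ℂ) else 0) = if x = y then 1 else 0 := by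
  by_cases h : x = y
  · simp [h]
  · rw [if_neg h]
    obtain ⟨v, hv⟩ := Function.ne_iff.1 h
    exact Finset.prod_eq_zero (Finset.mem_univ v) (if_neg hv)

theorem tensorOperator_one {n : ℕ} {L : Type} [Fintype L] [DecidableEq L] :
    tensorOperator (fun _ : Fin n => (1 : Matrix L L ℂ)) = 1 := by
  ext x y
  simp only [tensorOperator, Matrix.of_apply, Matrix.one_apply]
  exact prod_ite_eq_funext x y

theorem exchangeMessages_involutive {n b : ℕ} {W : Type} (x : QNetBasis n b W) :
    exchangeMessages (exchangeMessages x) = x := rfl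

variable {n b : ℕ} {I W : Type} [Fintype W] [DecidableEq W]

/-- The exchange of messages as an operator. -/
def exchangeMatrix (n b : ℕ) (W : Type) [Fintype W] [DecidableEq W] :
    Matrix (QNetBasis n b W) (QNetBasis n b W) ℂ :=
  Matrix.of fun x y => if exchangeMessages x = y then 1 else 0

theorem exchangeMatrix_mul_apply {K : Type} (A : Matrix (QNetBasis n b W) K ℂ)
    (x : QNetBasis n b W) (y : K) : (exchangeMatrix n b W * A) x y = A (exchangeMessages x) y := by
  simp [Matrix.mul_apply, exchangeMatrix]

theorem exchangeMatrix_mul_self : exchangeMatrix n b W * exchangeMatrix n b W = 1 := by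
  ext x y
  rw [exchangeMatrix_mul_apply, Matrix.one_apply]
  rfl

/-- The local operators of all nodes in one round. -/
abbrev Layer (n b : ℕ) (I W : Type) [Fintype W] [DecidableEq W] : Type :=
  Fin n → I → Unitary (QNodeBasis n b W)

/-- The operator of one round. -/
def layerMatrix (U : Layer n b I W) (inp : Fin n → I) :
    Matrix (QNetBasis n b W) (QNetBasis n b W) ℂ :=
  exchangeMatrix n b W * tensorOperator fun v => (U v (inp v)).1

/-- The operator of a sequence of rounds. -/
def protocolMatrix (inp : Fin n → I) :
    List (Layer n b I W) → Matrix (QNetBasis n b W) (QNetBasis n b W) ℂ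
  | [] => 1
  | U :: Γ => protocolMatrix inp Γ * layerMatrix U inp

theorem protocolMatrix_append (inp : Fin n → I) (Γ Δ : List (Layer n b I W)) :
    protocolMatrix inp (Γ ++ Δ) = protocolMatrix inp Δ * protocolMatrix inp Γ := by
  induction Γ with
  | nil => simp [protocolMatrix]
  | cons U Γ ih => simp only [List.cons_append, protocolMatrix, ih, mul_assoc]

theorem layerMatrix_one (inp : Fin n → I) :
    layerMatrix (1 : Layer n b I W) inp = exchangeMatrix n b W := by
  have : (fun v => ((1 : Layer n b I W) v (inp v)).1) = fun _ => 1 := rfl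
  rw [layerMatrix, this, tensorOperator_one, mul_one]

/-- The rounds that undo a protocol. -/
def inverseProtocol (Γ : List (Layer n b I W)) : List (Layer n b I W) :=
  1 :: ((Γ.map fun U => U⁻¹).reverse ++ [1])

theorem length_inverseProtocol (Γ : List (Layer n b I W)) :
    (inverseProtocol Γ).length = Γ.length + 2 := by
  simp [inverseProtocol]

/-- A round is `E U` with `E` the exchange, and its inverse `U⁻¹ E` has the exchange on the wrong
side. An idle round `E` at either end of the reversed product of the `E U⁻¹` repairs this. -/
theorem protocolMatrix_inverse_mul (inp : Fin n → I) (Γ : List (Layer n b I W)) :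
    protocolMatrix inp (inverseProtocol Γ) * protocolMatrix inp Γ = 1 := by
  have key : protocolMatrix inp (Γ.map fun U => U⁻¹).reverse *
      (exchangeMatrix n b W * protocolMatrix inp Γ) = exchangeMatrix n b W := by
    induction Γ with
    | nil => simp [protocolMatrix]
    | cons U Γ ih =>
      have h1 : layerMatrix U⁻¹ inp * (exchangeMatrix n b W * layerMatrix U inp)
          = exchangeMatrix n b W := by
        rw [layerMatrix, layerMatrix, ← mul_assoc (exchangeMatrix n b W) (exchangeMatrix n b W),
          exchangeMatrix_mul_self, one_mul, mul_assoc, tensorOperator_mul]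
        have : (fun v => (U⁻¹ v (inp v)).1 * (U v (inp v)).1)
            = fun _ => 1 := by
          funext v
          have := congrArg Subtype.val (inv_mul_cancel (U v (inp v)))
          exact this
        rw [this, tensorOperator_one, mul_one]
      rw [List.map_cons, List.reverse_cons, protocolMatrix_append]
      simp only [protocolMatrix, one_mul]
      rw [mul_assoc, ← mul_assoc (exchangeMatrix n b W), ← mul_assoc (protocolMatrix inp _), ih, h1]
  rw [inverseProtocol, protocolMatrix, protocolMatrix_append, layerMatrix_one, mul_assoc, mul_assoc,
    key]
  simp only [protocolMatrix, layerMatrix_one, one_mul, exchangeMatrix_mul_self]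

/-! ### Implementing operators on an embedded basis -/

/-- The linear map that sends the basis state `y` to the basis state `ι y`. -/
def embedMatrix {N : Type} [DecidableEq N] (ι : Y → N) : Matrix N Y ℂ :=
  Matrix.of fun z y => if z = ι y then 1 else 0

/-- Some protocol of at most `r` rounds takes the state `ι inp φ` to `ι' inp (u inp φ)`. -/
def Implements (r : ℕ) (ι ι' : (Fin n → I) → Y → QNetBasis n b W)
    (u : (Fin n → I) → Unitary Y) : Prop :=
  ∃ Γ : List (Layer n b I W), Γ.length ≤ r ∧ ∀ inp,
    protocolMatrix inp Γ * embedMatrix (ι inp) = embedMatrix (ι' inp) * (u inp : Matrix Y Y ℂ)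

namespace Implements

variable {ι ι' ι'' : (Fin n → I) → Y → QNetBasis n b W} {u u' : (Fin n → I) → Unitary Y} {r s : ℕ}

theorem mono (h : Implements r ι ι' u) (hrs : r ≤ s) : Implements s ι ι' u := by
  obtain ⟨Γ, h1, h2⟩ := h
  exact ⟨Γ, h1.trans hrs, h2⟩

theorem trans (h : Implements r ι ι' u) (h' : Implements s ι' ι'' u') :
    Implements (r + s) ι ι'' fun inp => u' inp * u inp := by
  obtain ⟨Γ, h1, h2⟩ := h
  obtain ⟨Δ, h3, h4⟩ := h'
  refine ⟨Γ ++ Δ, by simpa using add_le_add h1 h3, fun inp => ?_⟩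
  rw [protocolMatrix_append, Matrix.mul_assoc, h2, ← Matrix.mul_assoc, h4, Matrix.mul_assoc]
  rfl

theorem refl : Implements 0 ι ι fun _ => 1 :=
  ⟨[], le_rfl, fun inp => by simp [protocolMatrix]⟩

theorem inv (h : Implements r ι ι' u) : Implements (r + 2) ι' ι fun inp => (u inp)⁻¹ := by
  obtain ⟨Γ, h1, h2⟩ := h
  refine ⟨inverseProtocol Γ, by rw [length_inverseProtocol]; omega, fun inp => ?_⟩
  have h3 : (u inp : Matrix Y Y ℂ) * ((u inp)⁻¹ : Unitary Y).1 = 1 :=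
    congrArg Subtype.val (mul_inv_cancel (u inp))
  calc protocolMatrix inp (inverseProtocol Γ) * embedMatrix (ι' inp)
      = protocolMatrix inp (inverseProtocol Γ) *
          (embedMatrix (ι' inp) * (u inp : Matrix Y Y ℂ)) * ((u inp)⁻¹ : Unitary Y).1 := by
        simp only [Matrix.mul_assoc]; rw [h3, Matrix.mul_one]
    _ = protocolMatrix inp (inverseProtocol Γ) * protocolMatrix inp Γ *
          embedMatrix (ι inp) * ((u inp)⁻¹ : Unitary Y).1 := by
        rw [← h2]; simp only [Matrix.mul_assoc]
    _ = embedMatrix (ι inp) * ((u inp)⁻¹ : Unitary Y).1 := by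
        rw [protocolMatrix_inverse_mul, Matrix.one_mul]

/-- The transport of a unitary operator along a bijection of bases. -/
theorem reindex (e : X ≃ Y) {v : (Fin n → I) → Unitary X}
    (h : Implements r (fun inp => ι inp ∘ e) (fun inp => ι' inp ∘ e) v)
    (hv : ∀ inp x x', (v inp).1 x x' = (u inp).1 (e x) (e x')) : Implements r ι ι' u := by
  obtain ⟨Γ, h1, h2⟩ := h
  refine ⟨Γ, h1, fun inp => ?_⟩
  have hK : ∀ κ : Y → QNetBasis n b W, embedMatrix (κ ∘ e) = (embedMatrix κ).submatrix id e :=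
    fun κ => rfl
  have hu : (v inp).1 = (u inp).1.submatrix e e := by
    ext x x'; exact hv inp x x'
  have h3 := h2 inp
  rw [hK, hK, hu, Matrix.submatrix_mul_equiv] at h3
  have h4 : ((protocolMatrix inp Γ * embedMatrix (ι inp)).submatrix id e)
      = (embedMatrix (ι' inp) * (u inp).1).submatrix id e := by
    rw [← h3]
    ext x y
    simp [Matrix.mul_apply]
  ext x y
  have := congrFun (congrFun h4 x) (e.symm y)
  simpa using this

end Implements

/-! ### Rounds that permute basis states -/

/-- The unitary operator that permutes the basis states. -/
def permU (σ : Equiv.Perm X) : Unitary X :=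
  ⟨Matrix.of fun x y => if x = σ y then 1 else 0, by
    rw [Matrix.mem_unitaryGroup_iff]
    ext x y
    rw [Matrix.mul_apply, Matrix.one_apply, Finset.sum_eq_single (σ.symm x)]
    · simp [Matrix.star_apply, eq_comm]
    · intro z _ hz
      have : x ≠ σ z := fun h => hz (by simp [h])
      simp [this]
    · simp⟩

/-- The effect on basis states of a round in which node `v` applies the permutation `σ v`. -/
def permRound (σ : Fin n → Equiv.Perm (QNodeBasis n b W)) (x : QNetBasis n b W) :
    QNetBasis n b W :=
  exchangeMessages fun v => σ v (x v)

theorem layerMatrix_perm_mul_embedMatrix {Y : Type} (σ : Fin n → I → Equiv.Perm (QNodeBasis n b W))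
    (inp : Fin n → I) (ι : Y → QNetBasis n b W) :
    layerMatrix (fun v i => permU (σ v i)) inp * embedMatrix ι
      = embedMatrix fun y => permRound (fun v => σ v (inp v)) (ι y) := by
  ext x y
  rw [layerMatrix, Matrix.mul_assoc, exchangeMatrix_mul_apply, Matrix.mul_apply]
  rw [Finset.sum_eq_single (ι y) (fun z _ hz => by simp [embedMatrix, hz]) (by simp)]
  simp only [embedMatrix, Matrix.of_apply, if_true, mul_one, tensorOperator, permU]
  rw [prod_ite_eq_funext]
  refine if_congr ⟨fun h => ?_, fun h => ?_⟩ rfl rfl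
  · rw [permRound, ← h, exchangeMessages_involutive]
  · rw [h, permRound, exchangeMessages_involutive]

theorem Implements.perm (σ : Fin n → I → Equiv.Perm (QNodeBasis n b W))
    (ι ι' : (Fin n → I) → Y → QNetBasis n b W)
    (h : ∀ inp y, permRound (fun v => σ v (inp v)) (ι inp y) = ι' inp y) :
    Implements 1 ι ι' fun _ => 1 := by
  refine ⟨[fun v i => permU (σ v i)], le_rfl, fun inp => ?_⟩
  simp only [protocolMatrix, one_mul, layerMatrix_perm_mul_embedMatrix, h]
  exact (Matrix.mul_one _).symm


/-! ### Networks with a leader -/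

/-- The messages that a node has stored: for every slot, one message from every node. -/
abbrev History (n b : ℕ) (S : Type) : Type := S → Fin n → QMessage b

section Leader

variable {n b : ℕ} {I R S X C Y : Type} [Fintype R] [DecidableEq R] [Fintype S] [DecidableEq S]
  [Fintype X] [DecidableEq X] [Fintype C] [DecidableEq C] [Fintype Y] [DecidableEq Y]

/-- The basis state of the network in which the leader `l` has the register `x`, the other nodes
have the register `x₀`, the stored messages are `d`, and the message registers are empty. -/
def leaderState (l : Fin n) (x₀ x : R) (d : Fin n → History n b S) :
    QNetBasis n b (R × History n b S) :=
  fun v => ((if v = l then x else x₀, d v), fun _ _ => false)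

/-- The embedding of the space with basis `X × C` when the leader holds both registers, and the
stored messages depend on the second one. -/
def contextEmbed (l : Fin n) (x₀ : R) (ε : X × C ≃ R)
    (d : (Fin n → I) → C → Fin n → History n b S) (inp : Fin n → I) (y : X × C) :
    QNetBasis n b (R × History n b S) :=
  leaderState l x₀ (ε y) (d inp y.2)

theorem reindex_mem_unitaryGroup (e : Y ≃ R) (U : Unitary Y) :
    U.1.submatrix e.symm e.symm ∈ Matrix.unitaryGroup R ℂ := by
  rw [Matrix.mem_unitaryGroup_iff, Matrix.star_eq_conjTranspose, Matrix.conjTranspose_submatrix,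
    Matrix.submatrix_mul_equiv, ← Matrix.star_eq_conjTranspose, Matrix.mem_unitaryGroup_iff.1 U.2,
    Matrix.submatrix_one_equiv]

/-- The layer in which the leader applies an operator to its register. -/
def leaderLayer (l : Fin n) (ε : X × C ≃ R) (V : C → Unitary X) :
    Layer n b I (R × History n b S) :=
  fun v _ => if v = l then
    blockU fun _ => blockU fun _ => ⟨_, reindex_mem_unitaryGroup ε (blockU V)⟩ else 1

/-- Stored messages may depend on the `C`-component, so the leader acts alone only by operators that
are block diagonal over `C`. The message registers are empty, which makes the exchange harmless. -/
theorem implements_local (l : Fin n) (x₀ : R) (ε : X × C ≃ R)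
    (d : (Fin n → I) → C → Fin n → History n b S) (V : C → Unitary X) :
    Implements 1 (contextEmbed l x₀ ε d) (contextEmbed l x₀ ε d) fun _ => blockU V := by
  refine ⟨[leaderLayer l ε V], le_rfl, fun inp => ?_⟩
  rw [protocolMatrix, protocolMatrix, Matrix.one_mul, layerMatrix, Matrix.mul_assoc]
  have hex : exchangeMatrix n b (R × History n b S) * embedMatrix (contextEmbed l x₀ ε d inp)
      = embedMatrix (contextEmbed l x₀ ε d inp) := by
    ext z y
    rw [exchangeMatrix_mul_apply]
    simp only [embedMatrix, Matrix.of_apply]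
    refine if_congr ⟨fun h => ?_, fun h => ?_⟩ rfl rfl
    · rw [← exchangeMessages_involutive z, h]; rfl
    · rw [h]; rfl
  suffices h : (tensorOperator fun v => ((leaderLayer l ε V : Layer n b I (R × History n b S)) v (inp v)).1) *
      embedMatrix (contextEmbed l x₀ ε d inp)
      = embedMatrix (contextEmbed l x₀ ε d inp) * (blockU V).1 by
    rw [h, ← Matrix.mul_assoc, hex]
  ext z y
  rw [Matrix.mul_apply, Matrix.mul_apply,
    Finset.sum_eq_single (contextEmbed l x₀ ε d inp y)
      (fun w _ hw => by simp [embedMatrix, hw]) (by simp)]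
  -- The leader's register in `z` determines the only basis state whose image can be `z`.
  set y' := ε.symm (z l).1.1 with hy'
  rw [Finset.sum_eq_single y']
  rotate_left
  · intro w _ hw
    have : z ≠ contextEmbed l x₀ ε d inp w := by
      intro h
      apply hw
      rw [hy', h]
      simp [contextEmbed, leaderState]
    simp [embedMatrix, this]
  · simp
  simp only [embedMatrix, Matrix.of_apply, if_true, mul_one, tensorOperator]
  by_cases hc : y'.2 = y.2
  · rw [← prod_ite_eq_funext]
    have : ∀ v, ((leaderLayer l ε V : Layer n b I (R × History n b S)) v (inp v)).1 (z v)
        (contextEmbed l x₀ ε d inp y v) = (if z v = contextEmbed l x₀ ε d inp y' v then 1 else 0) *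
          (if v = l then (blockU V).1 y' y else 1) := by
      intro v
      by_cases hv : v = l
      · subst hv
        simp only [leaderLayer, if_true, blockU_apply, Matrix.submatrix_apply, ← hy']
        simp only [contextEmbed, leaderState, if_true, ← hc, Equiv.symm_apply_apply]
        simp only [Prod.ext_iff, hy', Equiv.apply_symm_apply, true_and]
        split_ifs <;> simp_all
      · simp only [leaderLayer, if_neg hv, mul_one]
        change (1 : Matrix _ _ ℂ) _ _ = _
        rw [Matrix.one_apply]
        simp only [contextEmbed, leaderState, if_neg hv, hc]
    simp only [this, Finset.prod_mul_distrib, Finset.prod_ite_eq', Finset.mem_univ, if_true]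
  · have h0 : (blockU V).1 y' y = 0 := by rw [blockU_apply, if_neg hc]
    rw [h0, mul_zero]
    apply Finset.prod_eq_zero (Finset.mem_univ l)
    simp only [leaderLayer, if_true, blockU_apply, Matrix.submatrix_apply, ← hy']
    simp only [contextEmbed, leaderState, if_true, Equiv.symm_apply_apply, if_neg hc]
    simp

/-- The permutation that adds the message `μ w` to the message registers. -/
def xorMessages {W : Type} (μ : W → Fin n → QMessage b) : Equiv.Perm (QNodeBasis n b W) :=
  Function.Involutive.toPerm (fun x => (x.1, fun u i => xor (x.2 u i) (μ x.1 u i))) fun x => by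
    simp

/-- The permutation that exchanges the contents of the message registers with a slot. -/
def swapSlot (s : S) : Equiv.Perm (QNodeBasis n b (R × History n b S)) :=
  Function.Involutive.toPerm (fun x => ((x.1.1, Function.update x.1.2 s x.2), x.1.2 s))
    fun x => by simp

/-- Every node sends messages that depend on its input, register and stored messages, and then
stores the messages that it has received in an empty slot. -/
theorem implements_round (l : Fin n) (x₀ : R) (ε : X × C ≃ R)
    (d d' : (Fin n → I) → C → Fin n → History n b S) (s : S)
    (μ : Fin n → I → R × History n b S → Fin n → QMessage b)
    (hs : ∀ inp c v, d inp c v s = fun _ _ => false)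
    (hd : ∀ inp c x v, d' inp c v = Function.update (d inp c v) s
      fun u => μ u (inp u) (if u = l then ε (x, c) else x₀, d inp c u) v) :
    Implements 2 (contextEmbed l x₀ ε d) (contextEmbed l x₀ ε d') fun _ => 1 := by
  -- The first round writes and delivers the messages. The second swaps them with the empty slot, so
  -- its exchange moves only empty messages.
  have h1 := Implements.perm (I := I) (Y := X × C) (fun v i => xorMessages (μ v i))
    (contextEmbed l x₀ ε d)
    (fun inp y => permRound (fun v => xorMessages (μ v (inp v))) (contextEmbed l x₀ ε d inp y))
    fun _ _ => rfl
  have h2 := Implements.perm (I := I) (Y := X × C) (fun _ _ => swapSlot s)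
    (fun inp y => permRound (fun v => xorMessages (μ v (inp v))) (contextEmbed l x₀ ε d inp y))
    (contextEmbed l x₀ ε d') ?_
  · simpa using h1.trans h2
  · rintro inp ⟨x, c⟩
    have hsw : ∀ v, (swapSlot s : Equiv.Perm (QNodeBasis n b (R × History n b S)))
        (permRound (fun v => xorMessages (μ v (inp v))) (contextEmbed l x₀ ε d inp (x, c)) v)
        = contextEmbed l x₀ ε d' inp (x, c) v := by
      intro v
      simp only [contextEmbed, leaderState, hd inp c x v]
      simp [swapSlot, permRound, xorMessages, exchangeMessages, leaderState,
        Function.Involutive.toPerm, hs]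
    funext v
    simp only [permRound, exchangeMessages] at hsw ⊢
    simp only [hsw]
    rfl

theorem Implements.of_perm {W : Type} [Fintype W] [DecidableEq W] {r : ℕ}
    {ι ι' : (Fin n → I) → Y → QNetBasis n b W} (σ : (Fin n → I) → Equiv.Perm Y)
    (h : Implements r ι (fun inp => ι' inp ∘ σ inp) fun _ => 1) :
    Implements r ι ι' fun inp => permU (σ inp) := by
  obtain ⟨Γ, h1, h2⟩ := h
  refine ⟨Γ, h1, fun inp => ?_⟩
  rw [h2]
  ext z y
  have h0 : (embedMatrix (ι' inp ∘ σ inp) * (1 : Unitary Y).1) = embedMatrix (ι' inp ∘ σ inp) :=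
    Matrix.mul_one _
  rw [h0, Matrix.mul_apply, Finset.sum_eq_single (σ inp y)]
  · simp [embedMatrix, permU]
  · intro w _ hw; simp [permU, hw]
  · simp

/-- The operator that negates a bit if `a` holds. -/
def flagU (a : Bool) : Unitary Bool := permU (if a then Equiv.boolNot else Equiv.refl _)

/-- The permutation of the first register by a permutation that depends on the second. -/
def blockPerm (τ : C → Equiv.Perm X) : Equiv.Perm (X × C) where
  toFun y := (τ y.2 y.1, y.2)
  invFun y := ((τ y.2).symm y.1, y.2)
  left_inv y := by simp
  right_inv y := by simp

theorem blockU_permU (τ : C → Equiv.Perm X) :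
    blockU (fun c => permU (τ c)) = permU (blockPerm τ) := by
  ext ⟨x, c⟩ ⟨x', c'⟩
  simp only [blockU_apply, permU, blockPerm, Matrix.of_apply, Equiv.coe_fn_mk, Prod.mk.injEq]
  by_cases h : c = c'
  · subst h; simp
  · simp [h]

/-- The permutation that negates the flag in the leader's register if some message in the slot `s`
has a one. -/
def flagPerm (ε : Bool × C ≃ R) (s : S) : Equiv.Perm (QNodeBasis n b (R × History n b S)) :=
  Function.Involutive.toPerm (fun x => ((ε (xor (ε.symm x.1.1).1
      (decide (∃ u i, x.1.2 s u i = true)), (ε.symm x.1.1).2), x.1.2), x.2)) fun x => by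
    simp

/-- The leader learns whether some node accepts its stored messages. -/
theorem implements_flag (l : Fin n) (x₀ : R) (ε : Bool × C ≃ R) (hb : 0 < b)
    (d : (Fin n → I) → C → Fin n → History n b S) (s : S)
    (hs : ∀ inp c v, d inp c v s = fun _ _ => false)
    (D : Fin n → I → History n b S → Bool) :
    Implements 7 (contextEmbed l x₀ ε d) (contextEmbed l x₀ ε d)
      fun inp => blockU fun c => flagU (decide (∃ v, D v (inp v) (d inp c v) = true)) := by
  set d' : (Fin n → I) → C → Fin n → History n b S := fun inp c v =>
    Function.update (d inp c v) s fun u _ => D u (inp u) (d inp c u) with hd'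
  have h1 := implements_round l x₀ ε d d' s (fun u i w _ _ => D u i w.2) hs
    fun inp c x v => rfl
  have h2 : Implements 1 (contextEmbed l x₀ ε d') (contextEmbed l x₀ ε d')
      fun inp => blockU fun c => flagU (decide (∃ v, D v (inp v) (d inp c v) = true)) := by
    simp only [flagU, blockU_permU]
    apply Implements.of_perm
    refine Implements.perm (fun v _ => if v = l then flagPerm ε s else Equiv.refl _) _ _ ?_
    rintro inp ⟨x, c⟩
    have hbit : (∃ u i, d' inp c l s u i = true) ↔ ∃ v, D v (inp v) (d inp c v) = true := by
      simp only [hd', Function.update_self]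
      exact ⟨fun ⟨u, _, h⟩ => ⟨u, h⟩, fun ⟨u, h⟩ => ⟨u, ⟨0, hb⟩, h⟩⟩
    have hx : ∀ v, (if v = l then flagPerm ε s else Equiv.refl _ :
        Equiv.Perm (QNodeBasis n b (R × History n b S))) (contextEmbed l x₀ ε d' inp (x, c) v)
        = contextEmbed l x₀ ε d' inp
          (blockPerm (fun c => if decide (∃ v, D v (inp v) (d inp c v) = true) = true
            then Equiv.boolNot else Equiv.refl _) (x, c)) v := by
      intro v
      by_cases hv : v = l
      · subst hv
        simp only [if_true, contextEmbed, leaderState, flagPerm, Function.Involutive.toPerm,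
          Equiv.coe_fn_mk, blockPerm, Equiv.symm_apply_apply, hbit]
        congr 3
        by_cases h : ∃ v, D v (inp v) (d inp c v) = true
        · simp [h]
        · simp [h]
      · simp [hv, contextEmbed, leaderState, blockPerm]
    funext v
    simp only [permRound, hx]
    rfl
  -- The votes are erased by undoing their distribution: `2 + 1 + (2 + 2)` rounds.
  have h3 := (h1.trans h2).trans h1.inv
  simpa using h3

end Leader


/-! ### Nested search -/

/-- The register of the leader for a search with `i` levels: a flag, and for every level the
register of the search space and the register for the number of iterations. -/
def SearchReg (N M : ℕ → ℕ) (k : ℕ) : ℕ → Type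
  | 0 => Bool
  | i + 1 => (SearchReg N M k i × Fin (N i + 1)) × (Fin k → Fin (M i + 1))

section Search

variable {N M : ℕ → ℕ} {k : ℕ}

instance searchRegFintype : (i : ℕ) → Fintype (SearchReg N M k i)
  | 0 => inferInstanceAs (Fintype Bool)
  | i + 1 =>
    have := searchRegFintype i
    inferInstanceAs (Fintype ((SearchReg N M k i × Fin (N i + 1)) × (Fin k → Fin (M i + 1))))

instance searchRegDecidableEq : (i : ℕ) → DecidableEq (SearchReg N M k i)
  | 0 => inferInstanceAs (DecidableEq Bool)
  | i + 1 =>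
    have := searchRegDecidableEq i
    inferInstanceAs (DecidableEq ((SearchReg N M k i × Fin (N i + 1)) × (Fin k → Fin (M i + 1))))

/-- The initial state of the registers. -/
def searchStart : (i : ℕ) → SearchReg N M k i
  | 0 => false
  | i + 1 => ((searchStart i, 0), 0)

/-- The states of the registers that report a solution. -/
def searchMarked : (i : ℕ) → SearchReg N M k i → Bool
  | 0, x => x
  | _ + 1, x => decide (x.2 ≠ 0)

variable {Λ : Type} (f : Λ → Bool) (fill : (i : ℕ) → Fin (N i + 1) → Λ → Λ)

/-- The preparation that is amplified at level `i`. -/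
noncomputable def searchPrep {i : ℕ} {X : Type} [Fintype X] [DecidableEq X]
    (A : Fin (N i + 1) → Unitary X) : Unitary (X × Fin (N i + 1)) :=
  blockU A * rightU (uniformU 0)

/-- The nested search with `i` levels. At every level a value is chosen and the data `d` are
extended accordingly; in the end `f` is evaluated. -/
noncomputable def searchU : (i : ℕ) → Λ → Unitary (SearchReg N M k i)
  | 0, d => flagU (f d)
  | i + 1, d => amplify (J := Fin k → Fin (M i + 1))
      (searchPrep fun q => searchU i (fill i q d)) (searchStart i, 0)
      (fun z => searchMarked i z.1) 0 (fun j => ∑ a, (j a : ℕ)) (k * M i)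

/-- Some sequence of choices leads to data that satisfy `f`. -/
def Satisfiable : ℕ → Λ → Prop
  | 0, d => f d = true
  | i + 1, d => ∃ q, Satisfiable i (fill i q d)

theorem searchPrep_apply {i : ℕ} {X : Type} [Fintype X] [DecidableEq X]
    (A : Fin (N i + 1) → Unitary X) (z : X × Fin (N i + 1)) (x : X) :
    (searchPrep A).1 z (x, 0) = (A z.2).1 z.1 x * (((Real.sqrt (N i + 1))⁻¹ : ℝ) : ℂ) := by
  have h := rightU_mul_blockU_mul_rightU_apply (1 : Unitary (Fin (N i + 1))) (uniformU 0) A z (x, 0)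
  rw [map_one, one_mul] at h
  rw [searchPrep, h, Finset.sum_eq_single z.2]
  · have h1 : ((1 : Unitary (Fin (N i + 1))).1 z.2 z.2) = 1 := Matrix.one_apply_eq _
    rw [h1, uniformU_apply, one_mul]; simp
  · intro j _ hj
    have h1 : ((1 : Unitary (Fin (N i + 1))).1 z.2 j) = 0 := Matrix.one_apply_ne hj.symm
    rw [h1]; ring
  · simp

theorem hitProb_searchPrep {i : ℕ} {X : Type} [Fintype X] [DecidableEq X]
    (A : Fin (N i + 1) → Unitary X) (x : X) (P : X → Bool) :
    (N i + 1) * hitProb (searchPrep A) (x, 0) (fun z => P z.1) = ∑ q, hitProb (A q) x P := by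
  simp only [hitProb, Fintype.sum_prod_type, searchPrep_apply]
  rw [Finset.sum_comm, Finset.mul_sum]
  refine Finset.sum_congr rfl fun q _ => ?_
  rw [Finset.mul_sum]
  refine Finset.sum_congr rfl fun y _ => ?_
  split_ifs
  · rw [norm_mul, Complex.norm_real, mul_pow, Real.norm_of_nonneg (by positivity), inv_pow,
      Real.sq_sqrt (by positivity)]
    field_simp
  · simp

theorem sum_le_mul (M : ℕ) (j : Fin k → Fin (M + 1)) : ∑ a, (j a : ℕ) ≤ k * M := by
  calc ∑ a, (j a : ℕ) ≤ ∑ _a : Fin k, M := Finset.sum_le_sum fun a _ => Nat.lt_succ_iff.1 (j a).2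
    _ = k * M := by simp

/-- No choice leads to a solution, so by induction the prepared state has no marked amplitude at
all; this exactness survives the nesting. -/
theorem searchU_eq_zero (i : ℕ) (d : Λ) (h : ¬ Satisfiable f fill i d) (x : SearchReg N M k i)
    (hx : searchMarked i x = true) : (searchU f fill i d).1 x (searchStart i) = 0 := by
  induction i generalizing d with
  | zero =>
    have hf : f d = false := by simpa [Satisfiable] using h
    have hx' : x = true := hx
    subst hx'
    change (flagU (f d)).1 true false = 0
    rw [hf]
    simp [flagU, permU]
  | succ i ih =>
    refine amplify_eq_zero (J := Fin k → Fin (M i + 1)) _ _ _ _ _ _ (sum_le_mul (M i)) ?_ x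
      (of_decide_eq_true hx)
    intro z hz
    rw [searchPrep_apply, ih _ (fun hs => h ⟨z.2, hs⟩) z.1 hz, zero_mul]

/-- A single good choice is enough: its inner search succeeds with probability at least `1/2`, so `a
≥ 1/(2(N i + 1))` and `a (M i + 1)^2 ≥ 2`. Only the bound `1/2` is used from the level below, so
errors do not accumulate. -/
theorem searchU_miss (hM : ∀ i, 4 * (N i + 1) ≤ (M i + 1) ^ 2) (hk : 1 ≤ k) (i : ℕ) (d : Λ)
    (h : Satisfiable f fill i d) :
    hitProb (searchU (N := N) (M := M) (k := k) f fill i d) (searchStart i)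
      (fun x => !searchMarked i x) ≤ (1 / 2) ^ k := by
  induction i generalizing d with
  | zero =>
    have hf : f d = true := h
    have : hitProb (flagU (f d)) false (fun x => !x) = 0 := by
      rw [hf]
      simp [hitProb, flagU, permU]
    exact this.le.trans (by positivity)
  | succ i ih =>
    obtain ⟨q, hq⟩ := h
    set A : Fin (N i + 1) → Unitary (SearchReg N M k i) := fun q => searchU f fill i (fill i q d)
      with hA
    set a := hitProb (searchPrep A) (searchStart i, 0) (fun z => searchMarked i z.1) with ha
    have hq2 : 1 / 2 ≤ hitProb (A q) (searchStart i) (searchMarked i) := by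
      have h1 := ih (fill i q d) hq
      have h2 := hitProb_add_not (A q) (searchStart i) (searchMarked i)
      have h3 : (1 / 2 : ℝ) ^ k ≤ 1 / 2 := by
        calc (1 / 2 : ℝ) ^ k ≤ (1 / 2) ^ 1 := pow_le_pow_of_le_one (by norm_num) (by norm_num) hk
          _ = 1 / 2 := pow_one _
      simp only [hA] at h2 ⊢
      linarith
    have hsum : 1 / 2 ≤ (N i + 1) * a := by
      rw [ha, hitProb_searchPrep]
      refine hq2.trans (Finset.single_le_sum (f := fun q => hitProb (A q) (searchStart i)
        (searchMarked i)) (fun q _ => ?_) (Finset.mem_univ q))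
      exact Finset.sum_nonneg fun z _ => by split_ifs <;> positivity
    have hM' : (4 : ℝ) * (N i + 1) ≤ (M i + 1) ^ 2 := by exact_mod_cast hM i
    have hapos : 0 < a := by
      by_contra hle
      have : (N i + 1 : ℝ) * a ≤ 0 := mul_nonpos_of_nonneg_of_nonpos (by positivity) (not_lt.1 hle)
      linarith
    have h2 : 2 ≤ a * (M i + 1) ^ 2 := by nlinarith
    have hmiss := amplify_miss (searchPrep A) (searchStart i, 0) (fun z => searchMarked i z.1)
      (M i) k (k * M i) (sum_le_mul (M i)) hapos
    rw [← ha] at hmiss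
    have heq : hitProb (searchU (N := N) (M := M) (k := k) f fill (i + 1) d) (searchStart (i + 1))
        (fun x => !searchMarked (i + 1) x) = ∑ z, ‖(amplify (searchPrep A) (searchStart i, 0)
          (fun z => searchMarked i z.1) (0 : Fin k → Fin (M i + 1)) (fun j => ∑ a, (j a : ℕ))
          (k * M i)).1 (z, 0) ((searchStart i, 0), 0)‖ ^ 2 := by
      change hitProb (Z := (SearchReg N M k i × Fin (N i + 1)) × (Fin k → Fin (M i + 1)))
        (amplify (searchPrep A) (searchStart i, 0)
          (fun z => searchMarked i z.1) (0 : Fin k → Fin (M i + 1)) (fun j => ∑ a, (j a : ℕ))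
          (k * M i)) ((searchStart i, 0), 0) (fun x => !decide (x.2 ≠ 0)) = _
      rw [hitProb, Fintype.sum_prod_type]
      refine Finset.sum_congr rfl fun z _ => ?_
      rw [Finset.sum_eq_single 0 (fun j _ hj => by simp [hj]) (by simp)]
      simp
    rw [heq]
    set s := ∑ z, ‖(amplify (searchPrep A) (searchStart i, 0)
          (fun z => searchMarked i z.1) (0 : Fin k → Fin (M i + 1)) (fun j => ∑ a, (j a : ℕ))
          (k * M i)).1 (z, 0) ((searchStart i, 0), 0)‖ ^ 2 with hs
    have hs0 : 0 ≤ s := Finset.sum_nonneg fun z _ => by positivity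
    have h3 : (2 : ℝ) ^ k * s ≤ 1 :=
      le_trans (mul_le_mul_of_nonneg_right (pow_le_pow_left₀ (by norm_num) h2 k) hs0) hmiss
    rw [div_pow, one_pow, le_div_iff₀ (by positivity)]
    linarith

end Search

/-! ### The nested search in a network -/

section Network

variable {n b : ℕ} {I R S X Z J C : Type} [Fintype R] [DecidableEq R] [Fintype S] [DecidableEq S]
  [Fintype X] [DecidableEq X] [Fintype Z] [DecidableEq Z] [Fintype J] [DecidableEq J]
  [Fintype C] [DecidableEq C]

theorem implements_controlledIterate (l : Fin n) (x₀ : R) (ε : (Z × J) × C ≃ R)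
    (d : (Fin n → I) → C → Fin n → History n b S) (D : (Fin n → I) → C → Unitary Z) (z₀ : Z)
    (P : Z → Bool) (e : J → ℕ) {r : ℕ}
    (hD : Implements r (contextEmbed l x₀ ε d) (contextEmbed l x₀ ε d)
      fun inp => blockU fun c => blockU fun _ => D inp c) (K : ℕ) :
    Implements (K * (2 * r + 4)) (contextEmbed l x₀ ε d) (contextEmbed l x₀ ε d)
      fun inp => blockU fun c => controlledIterate (D inp c) z₀ P e K := by
  induction K with
  | zero =>
    have h : (blockU fun _ : C => (1 : Unitary (Z × J))) = 1 := map_one blockU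
    simpa [controlledIterate, h] using Implements.refl (ι := contextEmbed l x₀ ε d)
  | succ K ih =>
    have h1 := implements_local l x₀ ε d fun _ =>
      phaseFlip (fun x : Z × J => P x.1 && decide (K < e x.2))
    have h2 := implements_local l x₀ ε d fun _ =>
      phaseFlip (fun x : Z × J => decide (x.1 ≠ z₀) && decide (K < e x.2))
    have h3 := (((ih.trans h1).trans hD.inv).trans h2).trans hD
    have heq : (fun inp => blockU fun c => controlledIterate (D inp c) z₀ P e (K + 1)) =
        fun inp => (blockU fun c => blockU fun _ => D inp c) * ((blockU fun _ =>
          phaseFlip (fun x : Z × J => decide (x.1 ≠ z₀) && decide (K < e x.2))) *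
          ((blockU fun c => blockU fun _ => D inp c)⁻¹ *
          ((blockU fun _ => phaseFlip (fun x : Z × J => P x.1 && decide (K < e x.2))) *
          blockU fun c => controlledIterate (D inp c) z₀ P e K))) := by
      funext inp
      rw [← map_inv, ← map_mul, ← map_mul, ← map_mul, ← map_mul]
      congr 1; funext c
      simp only [Pi.mul_apply, Pi.inv_apply, controlledIterate, controlledStep, mul_assoc]
    rw [heq]
    -- One more iteration costs two local rounds, `r` rounds for `D` and `r + 2` for its inverse.
    exact h3.mono (by ring_nf; omega)

theorem implements_amplify (l : Fin n) (x₀ : R) (ε : (Z × J) × C ≃ R)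
    (d : (Fin n → I) → C → Fin n → History n b S) (D : (Fin n → I) → C → Unitary Z) (z₀ : Z)
    (P : Z → Bool) (j₀ : J) (e : J → ℕ) {r : ℕ}
    (hD : Implements r (contextEmbed l x₀ ε d) (contextEmbed l x₀ ε d)
      fun inp => blockU fun c => blockU fun _ => D inp c) (K : ℕ) :
    Implements (r + 2 + K * (2 * r + 4)) (contextEmbed l x₀ ε d) (contextEmbed l x₀ ε d)
      fun inp => blockU fun c => amplify (D inp c) z₀ P j₀ e K := by
  have h1 := implements_local l x₀ ε d fun _ => rightU (Z := Z) (uniformU j₀)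
  have h2 := implements_local l x₀ ε d fun _ => (rightU (Z := Z) (uniformU j₀))⁻¹
  have h3 := ((h1.trans hD).trans (implements_controlledIterate l x₀ ε d D z₀ P e hD K)).trans h2
  have heq : (fun inp => blockU fun c => amplify (D inp c) z₀ P j₀ e K) =
      fun inp => (blockU fun _ => (rightU (Z := Z) (uniformU j₀))⁻¹) *
        ((blockU fun c => controlledIterate (D inp c) z₀ P e K) *
        ((blockU fun c => blockU fun _ => D inp c) *
        blockU fun _ => rightU (Z := Z) (uniformU j₀))) := by
    funext inp
    rw [← map_mul, ← map_mul, ← map_mul]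
    congr 1; funext c
    simp only [Pi.mul_apply, amplify, mul_assoc]
  rw [heq]
  exact h3.mono (by omega)

/-- The number of rounds of the nested search with `i` levels when the data of one choice at level
`i` are distributed in `L i` rounds. -/
def searchCost (L M : ℕ → ℕ) (k : ℕ) : ℕ → ℕ
  | 0 => 7
  | i + 1 => (searchCost L M k i + 2 * L i + 3) + 2 +
      k * M i * (2 * (searchCost L M k i + 2 * L i + 3) + 4)

/-- The induction generalizes the context `C`: the choice and the iteration register of a level
belong to the context of the search below it. `Free` is an invariant that provides the empty slots
for later messages. -/
theorem implements_search {N M L : ℕ → ℕ} {k t : ℕ} (l : Fin n) (x₀ : R) (hb : 0 < b)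
    (D : Fin n → I → History n b S → Bool)
    (fill : (Fin n → I) → (i : ℕ) → Fin (N i + 1) → (Fin n → History n b S) →
      (Fin n → History n b S))
    (Free : ℕ → (Fin n → History n b S) → Prop)
    (s : S) (hs : ∀ d, Free 0 d → ∀ v, d v s = fun _ _ => false)
    (hfill : ∀ inp i q d, i < t → Free (i + 1) d → Free i (fill inp i q d))
    (hload : ∀ i, i < t → ∀ (C : Type) [Fintype C] [DecidableEq C]
      (ε : SearchReg N M k i × (Fin (N i + 1) × C) ≃ R)
      (d : (Fin n → I) → C → Fin n → History n b S), (∀ inp c, Free (i + 1) (d inp c)) →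
      Implements (L i) (contextEmbed l x₀ ε fun inp c => d inp c.2)
        (contextEmbed l x₀ ε fun inp c => fill inp i c.1 (d inp c.2)) fun _ => 1)
    (i : ℕ) (hi : i ≤ t) (C : Type) [Fintype C] [DecidableEq C]
    (ε : SearchReg N M k i × C ≃ R)
    (d : (Fin n → I) → C → Fin n → History n b S) (hd : ∀ inp c, Free i (d inp c)) :
    Implements (searchCost L M k i) (contextEmbed l x₀ ε d) (contextEmbed l x₀ ε d)
      fun inp => blockU fun c => searchU (fun d => decide (∃ v, D v (inp v) (d v) = true))
        (fill inp) i (d inp c) := by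
  induction i generalizing C with
  | zero => exact implements_flag l x₀ ε hb d s (fun inp c => hs _ (hd inp c)) D
  | succ i ih =>
    have hi' : i < t := hi
    let ε₁ : ((SearchReg N M k i × Fin (N i + 1)) × (Fin k → Fin (M i + 1))) × C ≃ R := ε
    let e : SearchReg N M k i × (Fin (N i + 1) × ((Fin k → Fin (M i + 1)) × C)) ≃
        ((SearchReg N M k i × Fin (N i + 1)) × (Fin k → Fin (M i + 1))) × C :=
      (Equiv.prodAssoc _ _ _).symm.trans (Equiv.prodAssoc _ _ _).symm
    have hl := hload i hi' _ (e.trans ε₁) (fun inp jc => d inp jc.2) fun inp c => hd inp c.2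
    have hr := ih hi'.le _ (e.trans ε₁) (fun inp c => fill inp i c.1 (d inp c.2.2))
      fun inp c => hfill _ _ _ _ hi' (hd inp c.2.2)
    -- Unloading after the inner search restores the stored messages `d`, so the whole is an
    -- operator on the leader's register that can be iterated.
    have h1 := (hl.trans hr).trans hl.inv
    have h2 : Implements (L i + searchCost L M k i + (L i + 2)) (contextEmbed l x₀ ε₁ d)
        (contextEmbed l x₀ ε₁ d) fun inp => blockU fun c => blockU fun _ => blockU fun q =>
          searchU (fun d => decide (∃ v, D v (inp v) (d v) = true)) (fill inp) i
            (fill inp i q (d inp c)) := by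
      refine Implements.reindex e h1 ?_
      rintro inp ⟨x, q, j, c⟩ ⟨x', q', j', c'⟩
      simp only [inv_one, one_mul, mul_one, blockU_apply, e, Equiv.trans_apply,
        Equiv.prodAssoc_symm_apply, Prod.mk.injEq]
      by_cases h3 : q = q' <;> by_cases h4 : j = j' <;> by_cases h5 : c = c' <;> simp [h3, h4, h5]
    have h3 := implements_local l x₀ ε₁ d fun _ => blockU fun _ : Fin k → Fin (M i + 1) =>
      rightU (Z := SearchReg N M k i) (uniformU (0 : Fin (N i + 1)))
    have h4 : Implements (searchCost L M k i + 2 * L i + 3) (contextEmbed l x₀ ε₁ d)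
        (contextEmbed l x₀ ε₁ d) fun inp => blockU fun c => blockU fun _ : Fin k → Fin (M i + 1) =>
          searchPrep fun q => searchU (fun d => decide (∃ v, D v (inp v) (d v) = true))
            (fill inp) i (fill inp i q (d inp c)) := by
      have h5 := h3.trans h2
      refine Implements.mono (Eq.mp ?_ h5) (by omega : 1 + (L i + searchCost L M k i + (L i + 2)) ≤ _)
      congr 1
      funext inp
      rw [← map_mul]
      congr 1
      funext c
      rw [Pi.mul_apply, ← map_mul]
      rfl
    exact implements_amplify l x₀ ε₁ d _ (searchStart i, 0) (fun z => searchMarked i z.1)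
      (0 : Fin k → Fin (M i + 1)) (fun j => ∑ a, (j a : ℕ)) h4 (k * M i)

end Network


/-! ### Distributing the neighbourhoods of a batch of vertices -/

/-- The slot for the messages of round `r` at level `i`, for `i ≤ t` and `r ≤ m`. -/
def slot (t m i r : ℕ) : Fin (t + 1) × Fin (m + 1) := (Fin.ofNat _ i, Fin.ofNat _ r)

theorem slot_fst {t m i r : ℕ} (hi : i ≤ t) : ((slot t m i r).1 : ℕ) = i :=
  Nat.mod_eq_of_lt (Nat.lt_succ_of_le hi)

theorem slot_snd {t m i r : ℕ} (hr : r ≤ m) : ((slot t m i r).2 : ℕ) = r :=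
  Nat.mod_eq_of_lt (Nat.lt_succ_of_le hr)

theorem eq_slot_iff {t m i r : ℕ} (hi : i ≤ t) (hr : r ≤ m) (s : Fin (t + 1) × Fin (m + 1)) :
    s = slot t m i r ↔ (s.1 : ℕ) = i ∧ (s.2 : ℕ) = r := by
  rw [Prod.ext_iff, Fin.ext_iff, Fin.ext_iff, slot_fst hi, slot_snd hr]

/-- A message contains a one. -/
def HasOne {b : ℕ} (x : QMessage b) : Prop := ∃ i, x i = true

open Classical in
/-- The message that tells whether `P` holds. -/
noncomputable def bitMessage (b : ℕ) (P : Prop) : QMessage b := fun _ => decide P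

theorem hasOne_bitMessage {b : ℕ} (hb : 0 < b) (P : Prop) : HasOne (bitMessage b P) ↔ P := by
  simp only [HasOne, bitMessage, decide_eq_true_eq]
  exact ⟨fun ⟨_, h⟩ => h, fun h => ⟨⟨0, hb⟩, h⟩⟩

section Load

variable {n b t m : ℕ} (l : Fin n) (N B : ℕ → ℕ) (enc : (i : ℕ) → Fin (N i + 1) → QMessage b)

/-- The messages that every node receives in round `r` at level `i`, when the leader has chosen the
batch `q`: the first round announces the batch, and the other ones tell for every node whether it is
a neighbour of the respective vertex of the batch. -/
noncomputable def transcript (inp : Fin n → CliqueInput n) (i : ℕ) (q : Fin (N i + 1)) (r : ℕ)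
    (u : Fin n) : QMessage b :=
  if r = 0 then (if u = l then enc i q else fun _ => false)
  else bitMessage b (∃ w ∈ (inp u).neighbors, (w : ℕ) = q * B i + (r - 1))

/-- The stored messages after `r` rounds at level `i`. -/
noncomputable def fillTo (r : ℕ) (inp : Fin n → CliqueInput n) (i : ℕ) (q : Fin (N i + 1))
    (d : Fin n → History n b (Fin (t + 1) × Fin (m + 1))) :
    Fin n → History n b (Fin (t + 1) × Fin (m + 1)) :=
  fun v s => if (s.1 : ℕ) = i ∧ (s.2 : ℕ) < r then transcript l N B enc inp i q s.2 else d v s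

/-- The slots below level `i` and the slots of level `t` are empty. -/
def Free (i : ℕ) (d : Fin n → History n b (Fin (t + 1) × Fin (m + 1))) : Prop :=
  ∀ v s, (s.1 : ℕ) < i ∨ (s.1 : ℕ) = t → d v s = fun _ _ => false

variable {l N B enc}

theorem Free.fillTo {r : ℕ} {inp : Fin n → CliqueInput n} {i : ℕ} {q : Fin (N i + 1)}
    {d : Fin n → History n b (Fin (t + 1) × Fin (m + 1))} (hi : i < t) (h : Free (i + 1) d) :
    Free i (fillTo l N B enc r inp i q d) := by
  intro v s hs
  rw [QSearch.fillTo, if_neg (by omega)]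
  exact h v s (by omega)

/-- Only the leader can read the batch from its register; in later rounds all nodes decode it from
the announcement stored in slot `0` of the level. -/
theorem implements_fillTo {R X C : Type} [Fintype R] [DecidableEq R]
    [Fintype X] [DecidableEq X] [Fintype C] [DecidableEq C]
    (henc : ∀ i, Function.Injective (enc i)) (x₀ : R) (i : ℕ) (hi : i < t) (hB : B i ≤ m)
    (ε : X × (Fin (N i + 1) × C) ≃ R)
    (d : (Fin n → CliqueInput n) → C → Fin n → History n b (Fin (t + 1) × Fin (m + 1)))
    (hd : ∀ inp c, Free (i + 1) (d inp c)) (r : ℕ) (hr : r ≤ B i + 1) :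
    Implements (2 * r) (contextEmbed l x₀ ε fun inp c => d inp c.2)
      (contextEmbed l x₀ ε fun inp c => fillTo l N B enc r inp i c.1 (d inp c.2)) fun _ => 1 := by
  induction r with
  | zero =>
    have : ∀ inp (c : Fin (N i + 1) × C), fillTo l N B enc 0 inp i c.1 (d inp c.2) = d inp c.2 := by
      intro inp c
      funext v s
      simp [fillTo]
    simp only [this]
    exact Implements.refl
  | succ r ih =>
    have hrm : r ≤ m := by omega
    let dec : QMessage b → Fin (N i + 1) := Function.invFun (enc i)
    have hdec : ∀ q, dec (enc i q) = q := Function.leftInverse_invFun (henc i)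
    let μ : Fin n → CliqueInput n → R × History n b (Fin (t + 1) × Fin (m + 1)) → Fin n →
        QMessage b := fun u I w _ =>
      if r = 0 then (if u = l then enc i (ε.symm w.1).2.1 else fun _ => false)
      else bitMessage b (∃ v ∈ I.neighbors, (v : ℕ) = dec (w.2 (slot t m i 0) l) * B i + (r - 1))
    have h := implements_round l x₀ ε
      (fun inp c => fillTo l N B enc r inp i c.1 (d inp c.2))
      (fun inp c => fillTo l N B enc (r + 1) inp i c.1 (d inp c.2)) (slot t m i r) μ ?_ ?_
    · simpa [mul_add] using (ih (by omega)).trans h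
    · intro inp c v
      rw [fillTo, slot_snd hrm, if_neg (by omega)]
      exact hd _ _ _ _ (Or.inl (by rw [slot_fst hi.le]; omega))
    · intro inp c x v
      funext s
      rw [Function.update_apply]
      by_cases hs : s = slot t m i r
      · rw [if_pos hs]
        have hs' := (eq_slot_iff hi.le hrm s).1 hs
        rw [fillTo, if_pos (by omega), hs'.2]
        funext u
        by_cases h0 : r = 0
        · simp only [transcript, μ, if_pos h0]
          split_ifs <;> simp
        · have h1 : fillTo l N B enc r inp i c.1 (d inp c.2) u (slot t m i 0) l = enc i c.1 := by
            rw [fillTo, slot_fst hi.le, slot_snd (Nat.zero_le m), if_pos (by omega)]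
            simp [transcript]
          simp only [transcript, μ, if_neg h0, h1, hdec]
      · rw [if_neg hs]
        have hs' := mt (eq_slot_iff hi.le hrm s).2 hs
        simp only [fillTo]
        refine if_congr ?_ rfl rfl
        omega

variable (l N B enc)

/-- The distribution of the neighbourhoods of the batch `q` at level `i`. -/
noncomputable def fillBatch (inp : Fin n → CliqueInput n) (i : ℕ) :
    Fin (N i + 1) → (Fin n → History n b (Fin (t + 1) × Fin (m + 1))) →
      Fin n → History n b (Fin (t + 1) × Fin (m + 1)) :=
  fillTo l N B enc (B i + 1) inp i

/-- The stored messages after the distribution of the batches `q` at the levels below `i`. -/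
noncomputable def fillAll (inp : Fin n → CliqueInput n) (i : ℕ) (q : (j : ℕ) → Fin (N j + 1))
    (d : Fin n → History n b (Fin (t + 1) × Fin (m + 1))) :
    Fin n → History n b (Fin (t + 1) × Fin (m + 1)) :=
  fun v s => if (s.1 : ℕ) < i ∧ (s.2 : ℕ) < B s.1 + 1 then
    transcript l N B enc inp s.1 (q s.1) s.2 else d v s

/-- Levels write to disjoint slots, and what a level writes depends only on its own batch. The
nested choices therefore merge into one family. -/
theorem satisfiable_iff_fillAll
    (f : (Fin n → History n b (Fin (t + 1) × Fin (m + 1))) → Bool)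
    (inp : Fin n → CliqueInput n) (i : ℕ) (d : Fin n → History n b (Fin (t + 1) × Fin (m + 1))) :
    Satisfiable f (fillBatch l N B enc inp) i d ↔
      ∃ q, f (fillAll l N B enc inp i q d) = true := by
  induction i generalizing d with
  | zero =>
    have : ∀ q, fillAll l N B enc inp 0 q d = d := by
      intro q; funext v s; simp [fillAll]
    simp only [Satisfiable, this]
    exact ⟨fun h => ⟨fun _ => 0, h⟩, fun ⟨_, h⟩ => h⟩
  | succ i ih =>
    have key : ∀ q, fillAll l N B enc inp i q (fillBatch l N B enc inp i (q i) d)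
        = fillAll l N B enc inp (i + 1) q d := by
      intro q
      funext v s
      simp only [fillAll, fillBatch, fillTo]
      by_cases h1 : (s.1 : ℕ) = i
      · subst h1; simp
      · by_cases h2 : (s.1 : ℕ) < i
        · simp [h2, h1, Nat.lt_succ_of_lt h2]
        · have : ¬ (s.1 : ℕ) < i + 1 := by omega
          simp [h2, h1, this]
    simp only [Satisfiable, ih]
    constructor
    · rintro ⟨q₀, q, h⟩
      refine ⟨Function.update q i q₀, ?_⟩
      rw [← key, Function.update_self]
      convert h using 2
      funext v s
      simp only [fillAll]
      split_ifs with hs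
      · rw [Function.update_of_ne (by omega)]
      · rfl
    · rintro ⟨q, h⟩
      exact ⟨q i, q, by rwa [key]⟩

end Load

/-! ### The local decision -/

section Decision

variable {n b : ℕ} (t m : ℕ) (l : Fin n) (N B : ℕ → ℕ) (enc : (i : ℕ) → Fin (N i + 1) → QMessage b)

open Classical in
/-- A node accepts if one of its cliques, together with one vertex of the batch of every level,
is a clique. -/
noncomputable def accepts (_ : Fin n) (I : CliqueInput n)
    (h : History n b (Fin (t + 1) × Fin (m + 1))) : Bool :=
  decide (∃ s ∈ I.listed, ∃ (w : Fin t → Fin n) (a : Fin t → ℕ),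
    (∀ j : Fin t, a j < B j ∧
      (w j : ℕ) = (Function.invFun (enc j) (h (slot t m j 0) l)) * B j + a j) ∧
    (∀ j : Fin t, ∀ u ∈ s, HasOne (h (slot t m j (a j + 1)) u)) ∧
    ∀ j j' : Fin t, j ≠ j' → HasOne (h (slot t m j (a j + 1)) (w j')))

variable {l N B enc}

/-- The bit from `u` in slot `a + 1` of level `j` records adjacency to the vertex numbered `q j * B
j + a`. Division by `B j` recovers batch and offset. -/
theorem accepts_fillAll (hb : 0 < b) (henc : ∀ i, Function.Injective (enc i))
    (hB : ∀ i, i < t → B i ≤ m) (G : SimpleGraph (Fin n)) (S : Fin n → Set (Finset (Fin n)))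
    (v : Fin n) (q : (j : ℕ) → Fin (N j + 1))
    (d : Fin n → History n b (Fin (t + 1) × Fin (m + 1))) :
    accepts t m l N B enc v (cliqueInput G S v)
        (fillAll l N B enc (cliqueInput G S) t q d v) = true ↔
      ∃ s ∈ S v, ∃ w : Fin t → Fin n, (∀ j : Fin t, (w j : ℕ) / B j = q j ∧ 0 < B j) ∧
        (∀ j : Fin t, ∀ u ∈ s, G.Adj u (w j)) ∧ ∀ j j' : Fin t, j ≠ j' → G.Adj (w j') (w j) := by
  have h0 : ∀ j : Fin t, Function.invFun (enc j)
      (fillAll l N B enc (cliqueInput G S) t q d v (slot t m j 0) l) = q j := by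
    intro j
    have h1 : fillAll l N B enc (cliqueInput G S) t q d v (slot t m j 0) l = enc j (q j) := by
      rw [fillAll, slot_snd (Nat.zero_le m), slot_fst j.2.le, if_pos ⟨j.2, by omega⟩]
      simp [transcript]
    rw [h1]
    exact Function.leftInverse_invFun (henc j) (q j)
  have h1 : ∀ (j : Fin t) (a : ℕ) (u w : Fin n), a < B j → (w : ℕ) = q j * B j + a →
      (HasOne (fillAll l N B enc (cliqueInput G S) t q d v (slot t m j (a + 1)) u) ↔
        G.Adj u w) := by
    intro j a u w ha hw
    have hm : a + 1 ≤ m := by have := hB j j.2; omega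
    rw [fillAll, slot_snd hm, slot_fst j.2.le, if_pos ⟨j.2, by omega⟩, transcript,
      if_neg (Nat.succ_ne_zero a), hasOne_bitMessage hb, Nat.add_sub_cancel, ← hw]
    constructor
    · rintro ⟨w', hw', he⟩
      rw [← Fin.ext he]; exact hw'
    · intro h; exact ⟨w, h, rfl⟩
  simp only [accepts, decide_eq_true_eq, h0]
  constructor
  · rintro ⟨s, hs, w, a, h2, h3, h4⟩
    refine ⟨s, hs, w, fun j => ⟨?_, by have := (h2 j).1; omega⟩,
      fun j u hu => (h1 j (a j) u (w j) (h2 j).1 (h2 j).2).1 (h3 j u hu),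
      fun j j' hj => (h1 j (a j) (w j') (w j) (h2 j).1 (h2 j).2).1 (h4 j j' hj)⟩
    rw [(h2 j).2, mul_comm, Nat.mul_add_div (by have := (h2 j).1; omega),
      Nat.div_eq_of_lt (h2 j).1, add_zero]
  · rintro ⟨s, hs, w, h2, h3, h4⟩
    have h5 : ∀ j : Fin t, (w j : ℕ) % B j < B j ∧ (w j : ℕ) = q j * B j + (w j : ℕ) % B j := by
      intro j
      refine ⟨Nat.mod_lt _ (h2 j).2, ?_⟩
      rw [← (h2 j).1, mul_comm, Nat.div_add_mod]
    exact ⟨s, hs, w, fun j => (w j : ℕ) % B j, h5,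
      fun j u hu => (h1 j _ u (w j) (h5 j).1 (h5 j).2).2 (h3 j u hu),
      fun j j' hj => (h1 j _ (w j') (w j) (h5 j).1 (h5 j).2).2 (h4 j j' hj)⟩

/-- Adjacency is irreflexive, so the new vertices are distinct and outside `s`. Conversely, any
enumeration of `K \ s` serves. -/
theorem exists_extension_iff {p : ℕ} (G : SimpleGraph (Fin n)) (S : Fin n → Set (Finset (Fin n)))
    (hS : ListsAllCliques G p S) :
    (∃ v, ∃ s ∈ S v, ∃ w : Fin t → Fin n, (∀ j, ∀ u ∈ s, G.Adj u (w j)) ∧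
      ∀ j j', j ≠ j' → G.Adj (w j') (w j)) ↔ SomeListedExtends G S (p + t) := by
  have hclique : ∀ v, ∀ s ∈ S v, G.IsNClique p s := by
    intro v s hs
    have : s ∈ ⋃ u, S u := Set.mem_iUnion.2 ⟨v, hs⟩
    rw [hS] at this
    exact this
  constructor
  · rintro ⟨v, s, hs, w, h1, h2⟩
    have hinj : Function.Injective w := by
      intro j j' h
      by_contra hne
      exact (h2 j j' hne).ne h.symm
    have hdisj : Disjoint s (Finset.univ.image w) := by
      rw [Finset.disjoint_left]
      intro u hu hw
      obtain ⟨j, -, rfl⟩ := Finset.mem_image.1 hw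
      exact (h1 j _ hu).ne rfl
    refine ⟨s ∪ Finset.univ.image w, ⟨?_, ?_⟩, s, Set.mem_iUnion.2 ⟨v, hs⟩,
      Finset.subset_union_left⟩
    · intro x hx y hy hxy
      simp only [Finset.coe_union, Finset.coe_image, Finset.coe_univ, Set.image_univ,
        Set.mem_union, Finset.mem_coe, Set.mem_range] at hx hy
      rcases hx with hx | ⟨j, rfl⟩ <;> rcases hy with hy | ⟨j', rfl⟩
      · exact (hclique v s hs).isClique hx hy hxy
      · exact h1 j' x hx
      · exact (h1 j y hy).symm
      · exact h2 j' j fun h => hxy (by rw [h])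
    · rw [Finset.card_union_of_disjoint hdisj, (hclique v s hs).card_eq,
        Finset.card_image_of_injective _ hinj, Finset.card_univ, Fintype.card_fin]
  · rintro ⟨K, hK, s, hs, hsK⟩
    obtain ⟨v, hv⟩ := Set.mem_iUnion.1 hs
    have hcard : (K \ s).card = t := by
      rw [Finset.card_sdiff_of_subset hsK, hK.card_eq, (hclique v s hv).card_eq]; omega
    let e : Fin t ≃ (K \ s : Finset (Fin n)) := (Finset.equivFinOfCardEq hcard).symm
    have he : ∀ j, (e j : Fin n) ∈ K ∧ (e j : Fin n) ∉ s := fun j => Finset.mem_sdiff.1 (e j).2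
    refine ⟨v, s, hv, fun j => e j, fun j u hu => ?_, fun j j' hj => ?_⟩
    · exact hK.isClique (hsK hu) (he j).1 fun h => (he j).2 (by
        have h' : u = (e j : Fin n) := h
        rwa [← h'])
    · exact hK.isClique (he j').1 (he j).1 fun h => hj (e.injective (Subtype.ext h.symm))

end Decision

/-! ### The algorithm of a protocol -/

section Algorithm

variable {n b : ℕ} {I W : Type} [Fintype W] [DecidableEq W]

open Classical in
/-- The algorithm that executes a protocol, where the output of a node is the bit that it receives
from the node `l` in the last round. -/
noncomputable def protocolAlgorithm (l : Fin n) (w₀ : W) (Γ : List (Layer n b I W)) :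
    QCCAlgorithm n I where
  bandwidth := b
  rounds := Γ.length
  Work := W
  start := w₀
  gate v i r := Γ.getD r 1 v i
  output _ _ y := decide (HasOne (y.2 l))

theorem state_protocolAlgorithm (l : Fin n) (w₀ : W) (Γ : List (Layer n b I W)) (inp : Fin n → I)
    (r : ℕ) (hr : r ≤ Γ.length) :
    (protocolAlgorithm l w₀ Γ).state inp r = protocolMatrix inp (Γ.take r) *ᵥ
      (Pi.single (fun _ => (w₀, fun _ _ => false)) 1 : QNetBasis n b W → ℂ) := by
  induction r with
  | zero =>
    rw [List.take_zero, protocolMatrix, Matrix.one_mulVec]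
    rfl
  | succ r ih =>
    have hr' : r < Γ.length := hr
    have hstep : ∀ (U : Layer n b I W) (φ : QNetBasis n b W → ℂ), layerMatrix U inp *ᵥ φ =
        fun x => (tensorOperator (fun v => (U v (inp v)).1) *ᵥ φ) (exchangeMessages x) := by
      intro U φ
      rw [layerMatrix, ← Matrix.mulVec_mulVec]
      funext x
      simp [Matrix.mulVec, dotProduct, exchangeMatrix]
    rw [← List.take_concat_get' Γ r hr', protocolMatrix_append, ← Matrix.mulVec_mulVec,
      ← ih hr'.le, ← List.getD_eq_getElem Γ 1 hr', protocolMatrix, protocolMatrix, one_mul]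
    exact (hstep (Γ.getD r 1) _).symm

/-- The injection `ι'` takes basis states to basis states, so measuring the network amounts to
measuring the state that `U` prepares from `y₀`. -/
theorem outputProb_protocolAlgorithm {Y : Type} [Fintype Y] [DecidableEq Y] (l : Fin n) (w₀ : W)
    (Γ : List (Layer n b I W)) (inp : Fin n → I) (ι ι' : Y → QNetBasis n b W) (U : Unitary Y)
    (y₀ : Y) (hΓ : protocolMatrix inp Γ * embedMatrix ι = embedMatrix ι' * U.1)
    (h₀ : ι y₀ = fun _ => (w₀, fun _ _ => false)) (hι' : Function.Injective ι')
    (P : (Fin n → Bool) → Prop) (Q : Y → Bool)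
    (hQ : ∀ y, P (fun v => (protocolAlgorithm l w₀ Γ).output v (inp v) (ι' y v)) ↔ Q y = true) :
    (protocolAlgorithm l w₀ Γ).outputProb inp P = hitProb U y₀ Q := by
  classical
  have hst : (protocolAlgorithm l w₀ Γ).state inp (protocolAlgorithm l w₀ Γ).rounds
      = embedMatrix ι' *ᵥ fun y => U.1 y y₀ := by
    have h1 := state_protocolAlgorithm l w₀ Γ inp Γ.length le_rfl
    rw [List.take_length] at h1
    have h2 : (Pi.single (fun _ => (w₀, fun _ _ => false)) 1 : QNetBasis n b W → ℂ)
        = embedMatrix ι *ᵥ Pi.single y₀ 1 := by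
      rw [Matrix.mulVec_single_one]
      funext z
      simp [embedMatrix, Pi.single_apply, h₀]
    rw [h2, Matrix.mulVec_mulVec, hΓ, ← Matrix.mulVec_mulVec, Matrix.mulVec_single_one] at h1
    exact h1
  have hemb : ∀ y, (embedMatrix ι' *ᵥ fun y => U.1 y y₀) (ι' y) = U.1 y y₀ := by
    intro y
    simp [Matrix.mulVec, dotProduct, embedMatrix, hι'.eq_iff]
  rw [QCCAlgorithm.outputProb, hst, hitProb]
  refine (Finset.sum_of_injOn ι' hι'.injOn (fun _ _ => Finset.mem_coe.2 (Finset.mem_univ _)) ?_ ?_).symm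
  · intro z _ hz
    have : (embedMatrix ι' *ᵥ fun y => U.1 y y₀) z = 0 := by
      rw [Matrix.mulVec, dotProduct]
      refine Finset.sum_eq_zero fun y _ => ?_
      have : z ≠ ι' y := fun h => hz ⟨y, by simp, h.symm⟩
      simp [embedMatrix, this]
    simp [this]
  · intro y _
    rw [hemb]
    exact if_congr (hQ y).symm rfl rfl

end Algorithm

/-- The algorithm for given sizes of the batches and given numbers of iterations. -/
theorem exists_algorithm {n : ℕ} (hn : 1 ≤ n) (p t b k : ℕ) (hb : 0 < b) (hk : 1 ≤ k) (B M : ℕ → ℕ)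
    (hB : ∀ i, 0 < B i) (hM : ∀ i, 4 * (n / B i + 1) ≤ (M i + 1) ^ 2) (hnb : n + 1 ≤ 2 ^ b) :
    ∃ A : QCCAlgorithm n (CliqueInput n), A.bandwidth = b ∧
      A.rounds ≤ searchCost (fun i => 2 * (B i + 1)) M k t + 1 ∧
      ∀ (G : SimpleGraph (Fin n)) (S : Fin n → Set (Finset (Fin n))), ListsAllCliques G p S →
        1 - (1 / 2) ^ k ≤ A.outputProb (cliqueInput G S)
          (fun out => ∀ v, out v = true ↔ SomeListedExtends G S (p + t)) := by
  classical
  set N : ℕ → ℕ := fun i => n / B i with hN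
  -- Any common bound for the `B i` would do; memory is free.
  set m := ∑ i ∈ Finset.range t, B i with hm
  have hBm : ∀ i, i < t → B i ≤ m := fun i hi =>
    Finset.single_le_sum (fun _ _ => Nat.zero_le _) (Finset.mem_range.2 hi)
  let l : Fin n := ⟨0, hn⟩
  have henc' : ∀ i, Nonempty (Fin (N i + 1) ↪ QMessage b) := fun i => by
    apply Function.Embedding.nonempty_of_card_le
    simp only [Fintype.card_fin, Fintype.card_pi, Fintype.card_bool, Finset.prod_const,
      Finset.card_univ]
    exact (Nat.succ_le_succ (Nat.div_le_self n (B i))).trans hnb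
  let enc : (i : ℕ) → Fin (N i + 1) → QMessage b := fun i => (henc' i).some
  have henc : ∀ i, Function.Injective (enc i) := fun i => (henc' i).some.injective
  let R := SearchReg N M k t
  let x₀ : R := searchStart t
  let ε : R × Unit ≃ R := Equiv.prodUnique R Unit
  let d₀ : Fin n → History n b (Fin (t + 1) × Fin (m + 1)) := fun _ _ _ _ => false
  let D := accepts (b := b) t m l N B enc
  let f : (Fin n → CliqueInput n) → (Fin n → History n b (Fin (t + 1) × Fin (m + 1))) → Bool :=
    fun inp d => decide (∃ v, D v (inp v) (d v) = true)
  have hsearch := implements_search (N := N) (M := M) (L := fun i => 2 * (B i + 1)) (k := k) (t := t)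
    l x₀ hb D (fillBatch l N B enc) Free (slot t m t 0)
    (fun d hd v => hd v _ (Or.inr (slot_fst le_rfl)))
    (fun inp i q d hi h => h.fillTo hi)
    (fun i hi C _ _ ε d hd => implements_fillTo henc x₀ i hi (hBm i hi) ε d hd (B i + 1) le_rfl)
    t le_rfl Unit ε (fun _ _ => d₀) (fun _ _ _ _ _ => rfl)
  -- In one last round the leader broadcasts whether its register is marked, so all outputs agree.
  let μ : Fin n → R × History n b (Fin (t + 1) × Fin (m + 1)) → Fin n → QMessage b :=
    fun v w _ _ => decide (v = l) && searchMarked t w.1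
  let ι' : (Fin n → CliqueInput n) → R × Unit →
      QNetBasis n b (R × History n b (Fin (t + 1) × Fin (m + 1))) :=
    fun inp y => permRound (fun v => xorMessages (μ v)) (contextEmbed l x₀ ε (fun _ _ => d₀) inp y)
  have hann := Implements.perm (I := CliqueInput n) (fun v _ => xorMessages (μ v))
    (contextEmbed l x₀ ε (fun _ _ => d₀)) ι' fun _ _ => rfl
  obtain ⟨Γ, hlen, hΓ⟩ := hsearch.trans hann
  have hι' : ∀ inp, Function.Injective (ι' inp) := by
    intro inp y y' h
    have h1 := congrArg (fun z => (z l).1.1) h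
    simpa [ι', permRound, exchangeMessages, xorMessages, Function.Involutive.toPerm, contextEmbed,
      leaderState] using h1
  have hout : ∀ inp y v, (protocolAlgorithm l (x₀, fun _ _ _ => false) Γ).output v (inp v)
      (ι' inp y v) = searchMarked t y.1 := by
    intro inp y v
    have h1 : (ι' inp y v).2 l = fun _ => searchMarked t y.1 := by
      funext i
      simp [ι', permRound, exchangeMessages, xorMessages, Function.Involutive.toPerm, contextEmbed,
        leaderState, μ, ε]
    have h2 : HasOne ((ι' inp y v).2 l) ↔ searchMarked t y.1 = true := by
      rw [h1]; exact ⟨fun ⟨_, h⟩ => h, fun h => ⟨⟨0, hb⟩, h⟩⟩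
    have h3 : (protocolAlgorithm l (x₀, fun _ _ _ => false) Γ).output v (inp v) (ι' inp y v)
      = decide (HasOne ((ι' inp y v).2 l)) := rfl
    rw [h3]
    simp [h2]
  refine ⟨protocolAlgorithm l (x₀, fun _ _ _ => false) Γ, rfl, hlen, fun G S hS => ?_⟩
  set inp := cliqueInput G S with hinp
  set U : Unitary R := searchU (f inp) (fillBatch l N B enc inp) t d₀ with hU
  have hprob := outputProb_protocolAlgorithm l (x₀, fun _ _ _ => false) Γ inp
    (contextEmbed l x₀ ε (fun _ _ => d₀) inp) (ι' inp) _ (x₀, ()) (hΓ inp)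
    (by funext v; simp [contextEmbed, leaderState, ε, d₀]) (hι' inp)
    (fun out => ∀ v, out v = true ↔ SomeListedExtends G S (p + t))
    (fun y => decide (searchMarked t y.1 = true ↔ SomeListedExtends G S (p + t)))
    (fun y => by
      simp only [hout, decide_eq_true_eq]
      exact ⟨fun h => h l, fun h _ => h⟩)
  have hhit : ∀ Q : R → Bool, hitProb (1 * blockU fun _ : Unit => U) (x₀, ()) (fun y => Q y.1)
      = hitProb U x₀ Q := by
    intro Q
    rw [one_mul, hitProb, hitProb, Fintype.sum_prod_type]
    refine Finset.sum_congr rfl fun x _ => ?_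
    simp [blockU_apply]
  rw [hprob, hhit fun x => decide (searchMarked t x = true ↔ SomeListedExtends G S (p + t))]
  have hsat : Satisfiable (f inp) (fillBatch l N B enc inp) t d₀ ↔
      SomeListedExtends G S (p + t) := by
    rw [satisfiable_iff_fillAll, ← exists_extension_iff t G S hS]
    simp only [f, D, decide_eq_true_eq, hinp, accepts_fillAll t m hb henc hBm]
    constructor
    · rintro ⟨q, v, s, hs, w, -, h1, h2⟩
      exact ⟨v, s, hs, w, h1, h2⟩
    · rintro ⟨v, s, hs, w, h1, h2⟩
      -- The batch at a level is the one containing its vertex; values from `t` on are irrelevant.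
      refine ⟨fun j => if hj : j < t then ⟨(w ⟨j, hj⟩ : ℕ) / B j, ?_⟩ else 0, v, s, hs, w,
        fun j => ⟨by simp, hB j⟩, h1, h2⟩
      exact Nat.lt_succ_of_le (Nat.div_le_div_right (w ⟨j, hj⟩).2.le)
  by_cases hG : SomeListedExtends G S (p + t)
  · have h1 := searchU_miss (k := k) (f inp) (fillBatch l N B enc inp) hM hk t d₀ (hsat.2 hG)
    have h2 := hitProb_add_not U x₀ (searchMarked t)
    have h3 : (fun x : R => decide (searchMarked t x = true ↔ SomeListedExtends G S (p + t)))
        = searchMarked t := by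
      funext x; simp [hG]
    rw [h3]
    linarith
  · have h1 := searchU_eq_zero (M := M) (k := k) (f inp) (fillBatch l N B enc inp) t d₀
      (mt hsat.1 hG)
    have h2 := hitProb_add_not U x₀ (searchMarked t)
    have h3 : (fun x : R => decide (searchMarked t x = true ↔ SomeListedExtends G S (p + t)))
        = fun x => !searchMarked t x := by
      funext x; simp [hG]
    have h4 : hitProb U x₀ (searchMarked t) = 0 := by
      refine Finset.sum_eq_zero fun x _ => ?_
      split_ifs with hx
      · rw [hU, h1 x hx]; simp
      · rfl
    rw [h3]
    have : (0 : ℝ) ≤ (1 / 2) ^ k := by positivity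
    linarith


/-! ### The number of rounds -/

/-- The size of the batches at level `i`. -/
noncomputable def batchSize (n i : ℕ) : ℕ := ⌈(n : ℝ) ^ (1 - 1 / 2 ^ i : ℝ)⌉₊

/-- The number of iterations at level `i`. -/
noncomputable def iterations (n i : ℕ) : ℕ := 2 * Nat.sqrt (n / batchSize n i) + 1

/-- Here `iterations n i + 1` is twice the successor of the integer square root; this is the
condition in `searchU_miss`. -/
theorem four_mul_le_iterations (n i : ℕ) :
    4 * (n / batchSize n i + 1) ≤ (iterations n i + 1) ^ 2 := by
  have h := Nat.succ_le_succ_sqrt' (n / batchSize n i)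
  have h2 : (iterations n i + 1) ^ 2 = 4 * (Nat.sqrt (n / batchSize n i)).succ ^ 2 := by
    rw [iterations, Nat.succ_eq_add_one]; ring
  rw [h2]
  exact Nat.mul_le_mul_left 4 h

theorem exponent_nonneg (i : ℕ) : (0 : ℝ) ≤ 1 - 1 / 2 ^ i := by
  have : (1 : ℝ) / 2 ^ i ≤ 1 := by
    rw [div_le_one (by positivity)]
    exact one_le_pow₀ (by norm_num)
  linarith

theorem one_le_rpow_exponent {n : ℕ} (hn : 1 ≤ n) (i : ℕ) :
    (1 : ℝ) ≤ (n : ℝ) ^ (1 - 1 / 2 ^ i : ℝ) :=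
  Real.one_le_rpow (by exact_mod_cast hn) (exponent_nonneg i)

theorem batchSize_pos {n : ℕ} (hn : 1 ≤ n) (i : ℕ) : 0 < batchSize n i :=
  Nat.ceil_pos.2 (zero_lt_one.trans_le (one_le_rpow_exponent hn i))

theorem batchSize_le {n : ℕ} (hn : 1 ≤ n) (i : ℕ) :
    (batchSize n i : ℝ) ≤ 2 * (n : ℝ) ^ (1 - 1 / 2 ^ i : ℝ) := by
  have h := one_le_rpow_exponent hn i
  have := (Nat.ceil_lt_add_one (zero_le_one.trans h)).le
  rw [batchSize]
  linarith

theorem rpow_exponent_succ {n : ℕ} (hn : 1 ≤ n) (i : ℕ) :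
    (n : ℝ) ^ (1 - 1 / 2 ^ i : ℝ) * (n : ℝ) ^ (1 / 2 ^ (i + 1) : ℝ)
      = (n : ℝ) ^ (1 - 1 / 2 ^ (i + 1) : ℝ) := by
  rw [← Real.rpow_add (by exact_mod_cast hn)]
  congr 1
  rw [pow_succ]
  field_simp
  ring

theorem one_le_rpow_inv {n : ℕ} (hn : 1 ≤ n) (i : ℕ) :
    (1 : ℝ) ≤ (n : ℝ) ^ (1 / 2 ^ (i + 1) : ℝ) :=
  Real.one_le_rpow (by exact_mod_cast hn) (by positivity)

theorem iterations_le {n : ℕ} (hn : 1 ≤ n) (i : ℕ) :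
    (iterations n i : ℝ) ≤ 3 * (n : ℝ) ^ (1 / 2 ^ (i + 1) : ℝ) := by
  have hn0 : (0 : ℝ) < n := by exact_mod_cast hn
  set s := Nat.sqrt (n / batchSize n i) with hs
  set y := (n : ℝ) ^ (1 / 2 ^ (i + 1) : ℝ) with hy
  have hy1 : 1 ≤ y := one_le_rpow_inv hn i
  have hyy : y ^ 2 * (n : ℝ) ^ (1 - 1 / 2 ^ i : ℝ) = n := by
    rw [hy, ← Real.rpow_natCast, ← Real.rpow_mul hn0.le, ← Real.rpow_add hn0]
    conv_rhs => rw [← Real.rpow_one (n : ℝ)]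
    congr 1
    rw [pow_succ]
    push_cast
    field_simp
    ring
  have h1 : s ^ 2 * batchSize n i ≤ n :=
    (Nat.mul_le_mul_right _ (Nat.sqrt_le' _)).trans (Nat.div_mul_le_self _ _)
  have h2 : (s : ℝ) ^ 2 * (n : ℝ) ^ (1 - 1 / 2 ^ i : ℝ) ≤ n := by
    calc (s : ℝ) ^ 2 * (n : ℝ) ^ (1 - 1 / 2 ^ i : ℝ) ≤ (s : ℝ) ^ 2 * batchSize n i := by
          gcongr; exact Nat.le_ceil _
      _ ≤ (n : ℝ) := by exact_mod_cast h1
  have hb : (0 : ℝ) < (n : ℝ) ^ (1 - 1 / 2 ^ i : ℝ) := by positivity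
  have h3 : (s : ℝ) ^ 2 ≤ y ^ 2 := le_of_mul_le_mul_right (h2.trans hyy.ge) hb
  have h4 : (s : ℝ) ≤ y := le_of_sq_le_sq h3 (by linarith)
  rw [iterations, ← hs]
  push_cast
  linarith

/-- Inner search and loading are both `O(k^i n^(1 - 1/2^i))`. The iterations multiply this by `k
n^(1/2^(i+1))`, which yields the next exponent exactly. -/
theorem exists_searchCost_le (i : ℕ) : ∃ C : ℝ, 0 ≤ C ∧ ∀ n k : ℕ, 1 ≤ n → 1 ≤ k →
    (searchCost (fun i => 2 * (batchSize n i + 1)) (iterations n) k i : ℝ)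
      ≤ C * k ^ i * (n : ℝ) ^ (1 - 1 / 2 ^ i : ℝ) := by
  induction i with
  | zero => exact ⟨7, by norm_num, fun n k _ _ => by simp [searchCost]⟩
  | succ i ih =>
    obtain ⟨C, hC, h⟩ := ih
    -- From `B ≤ 2β` and `1 ≤ β` one gets `4B + 9 ≤ 17β`; the `7` is `1 + 3 * 2`, with `3` from
    -- `iterations_le`.
    refine ⟨7 * (C + 17), by positivity, fun n k hn hk => ?_⟩
    have hk' : (1 : ℝ) ≤ k := by exact_mod_cast hk
    have h1 := h n k hn hk
    have h2 := batchSize_le hn i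
    have h3 := iterations_le hn i
    have h4 := one_le_rpow_exponent hn i
    have h5 := one_le_rpow_inv hn i
    rw [← rpow_exponent_succ hn i, searchCost]
    push_cast
    set c := (searchCost (fun i => 2 * (batchSize n i + 1)) (iterations n) k i : ℝ)
    set β := (n : ℝ) ^ (1 - 1 / 2 ^ i : ℝ)
    set y := (n : ℝ) ^ (1 / 2 ^ (i + 1) : ℝ)
    set B := (batchSize n i : ℝ)
    set M := (iterations n i : ℝ)
    have hki : (1 : ℝ) ≤ (k : ℝ) ^ i := one_le_pow₀ hk'
    have hβ : β ≤ k ^ i * β := le_mul_of_one_le_left (by linarith) hki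
    have hY : c + 2 * (2 * (B + 1)) + 5 ≤ (C + 17) * k ^ i * β := by
      have : (C + 17) * (k : ℝ) ^ i * β = C * k ^ i * β + 17 * (k ^ i * β) := by ring
      rw [this]
      linarith
    have hY0 : 0 ≤ (C + 17) * (k : ℝ) ^ i * β := by positivity
    have hky : 1 ≤ k * y := one_le_mul_of_one_le_of_one_le hk' h5
    calc c + 2 * (2 * (B + 1)) + 3 + 2 + k * M * (2 * (c + 2 * (2 * (B + 1)) + 3) + 4)
        = (c + 2 * (2 * (B + 1)) + 5) + k * M * (2 * (c + 2 * (2 * (B + 1)) + 5)) := by ring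
      _ ≤ (C + 17) * k ^ i * β + k * (3 * y) * (2 * ((C + 17) * k ^ i * β)) := by gcongr
      _ ≤ (C + 17) * k ^ i * β * (k * y) + k * (3 * y) * (2 * ((C + 17) * k ^ i * β)) := by
          exact add_le_add_left (le_mul_of_one_le_right hY0 hky) _
      _ = 7 * (C + 17) * k ^ (i + 1) * (β * y) := by ring

/-- The exponent of the error probability. -/
noncomputable def repetitions (c : ℝ) (n : ℕ) : ℕ := ⌈c * Real.logb 2 n⌉₊ + 1

theorem half_pow_repetitions_le (c : ℝ) {n : ℕ} (hn : 1 ≤ n) :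
    (1 / 2 : ℝ) ^ repetitions c n ≤ (n : ℝ) ^ (-c) := by
  have hn0 : (0 : ℝ) < n := by exact_mod_cast hn
  have h1 : c * Real.logb 2 n ≤ repetitions c n := by
    rw [repetitions]
    push_cast
    linarith [Nat.le_ceil (c * Real.logb 2 n)]
  have h2 : (n : ℝ) ^ (-c) = (2 : ℝ) ^ (-(c * Real.logb 2 n)) := by
    have : -(c * Real.logb 2 n) = Real.logb 2 n * -c := by ring
    rw [this, Real.rpow_mul (by norm_num), Real.rpow_logb (by norm_num) (by norm_num) hn0]
  have h3 : (1 / 2 : ℝ) ^ repetitions c n = (2 : ℝ) ^ (-(repetitions c n : ℝ)) := by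
    rw [Real.rpow_neg (by norm_num), Real.rpow_natCast, one_div, inv_pow]
  rw [h2, h3]
  exact Real.rpow_le_rpow_of_exponent_le (by norm_num) (neg_le_neg h1)

theorem one_le_log {n : ℕ} (hn : 3 ≤ n) : 1 ≤ Real.log n := by
  rw [Real.le_log_iff_exp_le (by positivity)]
  have h : (3 : ℝ) ≤ n := by exact_mod_cast hn
  linarith [Real.exp_one_lt_d9]

theorem repetitions_le {c : ℝ} (hc : 0 < c) {n : ℕ} (hn : 3 ≤ n) :
    (repetitions c n : ℝ) ≤ (c / Real.log 2 + 2) * Real.log n := by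
  have h1 := one_le_log hn
  have h2 : 0 < Real.log 2 := Real.log_pos (by norm_num)
  have h3 : c * Real.logb 2 n = c / Real.log 2 * Real.log n := by
    rw [Real.logb]; ring
  have h4 : 0 ≤ c * Real.logb 2 n := by rw [h3]; positivity
  have h5 := (Nat.ceil_lt_add_one h4).le
  rw [repetitions]
  push_cast
  linarith

end QSearch

open QSearch in
theorem mainTheorem4 (p t : ℕ) (hp : 2 ≤ p) (ht : 1 ≤ t) (c : ℝ) (hc : 0 < c) :
    ∃ A : ∀ n : ℕ, QCCAlgorithm n (CliqueInput n),
      (fun n => ((A n).bandwidth : ℝ)) =O[atTop] (fun n : ℕ => Real.log n) ∧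
      IsSoftO (fun n => ((A n).rounds : ℝ)) (fun n => (n : ℝ) ^ (1 - 1 / 2 ^ t : ℝ)) ∧
      ExtendsCliques p t c A := by
  have hA : ∀ n : ℕ, ∃ A : QCCAlgorithm n (CliqueInput n), 1 ≤ n →
      A.bandwidth = Nat.log 2 n + 1 ∧
      A.rounds ≤ searchCost (fun i => 2 * (batchSize n i + 1)) (iterations n)
        (repetitions c n) t + 1 ∧
      ∀ (G : SimpleGraph (Fin n)) (S : Fin n → Set (Finset (Fin n))), ListsAllCliques G p S →
        1 - (1 / 2) ^ repetitions c n ≤ A.outputProb (cliqueInput G S)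
          (fun out => ∀ v, out v = true ↔ SomeListedExtends G S (p + t)) := by
    intro n
    rcases Nat.eq_zero_or_pos n with hn | hn
    -- Nothing is required of the empty network, so any algorithm will do.
    · exact ⟨⟨0, 0, Unit, (), fun _ _ _ => 1, fun _ _ _ => true⟩, fun h => by omega⟩
    · obtain ⟨A, h⟩ := exists_algorithm hn p t (Nat.log 2 n + 1) (repetitions c n)
        (Nat.succ_pos _) (Nat.succ_le_succ (Nat.zero_le _)) (batchSize n) (iterations n)
        (batchSize_pos hn) (four_mul_le_iterations n) (Nat.lt_pow_succ_log_self (by norm_num) n)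
      exact ⟨A, fun _ => h⟩
  choose A hA using hA
  -- The power of the logarithm is `t`: each level contributes one factor `repetitions c n = O(log
  -- n)`.
  refine ⟨A, ?_, ⟨t, ?_⟩, fun n hn G S hS => ?_⟩
  · refine IsBigO.of_bound (1 / Real.log 2 + 1) (eventually_atTop.2 ⟨3, fun n hn => ?_⟩)
    have h1 := one_le_log hn
    rw [(hA n (by omega)).1, Real.norm_of_nonneg (by positivity), Real.norm_of_nonneg (by linarith)]
    have h2 : (Nat.log 2 n : ℝ) ≤ Real.logb 2 n := Real.natLog_le_logb n 2
    have h3 : Real.logb 2 n = 1 / Real.log 2 * Real.log n := by rw [Real.logb]; ring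
    push_cast
    linarith
  · obtain ⟨C, hC, hcost⟩ := exists_searchCost_le t
    refine IsBigO.of_bound ((C + 1) * (c / Real.log 2 + 2) ^ t)
      (eventually_atTop.2 ⟨3, fun n hn => ?_⟩)
    have hn1 : 1 ≤ n := by omega
    have h1 := one_le_log hn
    have h2 := one_le_rpow_exponent hn1 t
    have h3 := hcost n (repetitions c n) hn1 (Nat.succ_le_succ (Nat.zero_le _))
    have h4 : ((A n).rounds : ℝ) ≤ searchCost (fun i => 2 * (batchSize n i + 1)) (iterations n)
        (repetitions c n) t + 1 := by exact_mod_cast (hA n hn1).2.1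
    have h5 : (1 : ℝ) ≤ (repetitions c n : ℝ) ^ t := one_le_pow₀ (by
      exact_mod_cast Nat.succ_le_succ (Nat.zero_le _))
    have h6 := repetitions_le hc hn
    rw [Real.norm_of_nonneg (by positivity), Real.norm_of_nonneg (by positivity)]
    calc ((A n).rounds : ℝ)
        ≤ C * (repetitions c n : ℝ) ^ t * (n : ℝ) ^ (1 - 1 / 2 ^ t : ℝ) + 1 := by linarith
      _ ≤ C * (repetitions c n : ℝ) ^ t * (n : ℝ) ^ (1 - 1 / 2 ^ t : ℝ)
          + (repetitions c n : ℝ) ^ t * (n : ℝ) ^ (1 - 1 / 2 ^ t : ℝ) := by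
          gcongr
          exact one_le_mul_of_one_le_of_one_le h5 h2
      _ = (C + 1) * (repetitions c n : ℝ) ^ t * (n : ℝ) ^ (1 - 1 / 2 ^ t : ℝ) := by ring
      _ ≤ (C + 1) * ((c / Real.log 2 + 2) * Real.log n) ^ t * (n : ℝ) ^ (1 - 1 / 2 ^ t : ℝ) := by
          gcongr
      _ = (C + 1) * (c / Real.log 2 + 2) ^ t *
          ((n : ℝ) ^ (1 - 1 / 2 ^ t : ℝ) * Real.log n ^ t) := by rw [mul_pow]; ring
  · have h1 := (hA n hn).2.2 G S hS
    have h2 := half_pow_repetitions_le c hn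
    linarith
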